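/- Let $N$ be an inhomogeneous Poisson process on $[0,\infty)$ with locally integrable intensity function $\lambda\ge 0$ and cumulative intensity $m(t)=\int_0^t\lambda(s)\,ds$ (that is, $N(0)=0$ almost surely, $N$ has independent increments, and $N(t)-N(s)$ is Poisson distributed with mean $m(t)-m(s)$ for $s\le t$), and let $T_1\le T_2\le\dots$ be its arrival times, so that $N(t)=\#\{i\ge 1: T_i\le t\}$. Let $\alpha>0$ and let $(X_i)_{i\ge 0}$ be identically distributed, not necessarily independent, non-negative random variables such that * the tail $x\mapsto \mathbb P(X_1>x)$ is regularly varying with index $-\alpha$, i.e. $\mathbb P(X_1>cx)/\mathbb P(X_1>x)\to c^{-\alpha}$ as $x\to\infty$ for every $c>0$; * $\displaystyle\sup_{i\ne j,\ i,j\ge1}\frac{\mathbb P(X_i>x,\,X_j>x)}{\mathbb P(X_1>x)}\to 0$ as $x\to\infty$. Let $(h_i)_{i\ge 0}$ be i.i.d. jointly measurable random functions with $h_i(t,s)\ge 0$, such that $t\mapsto h_i(t,s)$ is non-increasing on $[s,\infty)$ for every $s>0$. Assume that the three families $(X_i)$, $(h_i)$ and $(T_i)$ are mutually independent, and consider the shot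 noise process and its finite-time ruin probability $$Y(t)=\sum_{i=1}^{N(t)}X_i\,h_i(t,T_i),\quad t\ge 0,\qquad\qquad \psi(x,T)=\mathbb P\Big(\sup_{0\le t\le T}Y(t)>x\Big).$$ Let $T>0$ with $m(T)>0$, let $V_0$ be a random variable with density $\lambda(t)/m(T)$, $0\le t\le T$, independent of $h_0$, and assume that $\mathbb E[h_0(V_0,V_0)^p]<\infty$ for some $p>\alpha$. Then $$\lim_{x\to\infty}\frac{\psi(x,T)}{\mathbb P(X_1>x)}=m(T)\,\mathbb E\big[h_0(V_0,V_0)^{\alpha}\big].$$ -/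

import Mathlib

open MeasureTheory ProbabilityTheory Filter Topology
open scoped NNReal ENNReal

noncomputable section

/-- The tail (survival) function `x ↦ ℙ(Z > x)` of a real random variable `Z`. -/
def tail {Ω : Type*} [MeasurableSpace Ω] (μ : Measure Ω) (Z : Ω → ℝ) (x : ℝ) : ℝ :=
  μ.real {ω | x < Z ω}

/-- `f` is regularly varying at infinity with index `ρ`: `f (c x) / f x → c ^ ρ` as `x → ∞`,
for every `c > 0`. (As the limit is nonzero, `f` cannot vanish at arbitrarily large points.) -/
def RegularlyVarying (f : ℝ → ℝ) (ρ : ℝ) : Prop :=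
  ∀ c : ℝ, 0 < c → Tendsto (fun x => f (c * x) / f x) atTop (𝓝 (c ^ ρ))

/-- Uniform bivariate upper tail independence of `X 1, X 2, …`:
`sup_{i ≠ j, i, j ≥ 1} ℙ(X i > x, X j > x) / ℙ(X 1 > x) → 0` as `x → ∞`. -/
def UniformTailIndependent {Ω : Type*} [MeasurableSpace Ω] (μ : Measure Ω)
    (X : ℕ → Ω → ℝ) : Prop :=
  Tendsto
    (fun x : ℝ => ⨆ p : {p : ℕ × ℕ // 1 ≤ p.1 ∧ 1 ≤ p.2 ∧ p.1 ≠ p.2},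
      μ.real {ω | x < X p.1.1 ω ∧ x < X p.1.2 ω} / tail μ (X 1) x)
    atTop (𝓝 0)

/-- `τ 1 ≤ τ 2 ≤ …` is a sequence of random arrival times in `[0, ∞]`, only finitely many of
which lie in any bounded time interval. (The value `∞` means that the arrival never happens; the
entry `τ 0` plays no role.) -/
structure IsArrivalSequence {Ω : Type*} [MeasurableSpace Ω] (τ : ℕ → Ω → ℝ≥0∞) : Prop where
  measurable : ∀ i, Measurable (τ i)
  mono : ∀ ω i j, 1 ≤ i → i ≤ j → τ i ω ≤ τ j ω
  locallyFinite : ∀ ω (t : ℝ≥0), {i : ℕ | 1 ≤ i ∧ τ i ω ≤ t}.Finite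

/-- The counting process `N(t) = #{i ≥ 1 : τ i ≤ t}`. -/
def arrivalCount {Ω : Type*} (τ : ℕ → Ω → ℝ≥0∞) (t : ℝ≥0) (ω : Ω) : ℕ :=
  {i : ℕ | 1 ≤ i ∧ τ i ω ≤ t}.ncard

/-- The cumulative intensity `m(t) = ∫₀ᵗ lam(s) ds`. -/
def cumIntensity (lam : ℝ → ℝ) (t : ℝ) : ℝ :=
  ∫ s in (0 : ℝ)..t, lam s

/-- `N` is an inhomogeneous Poisson process with intensity function `lam`: `N 0 = 0` almost surely,
the increments are independent, and `N t - N s` is Poisson distributed with mean `m(t) - m(s)`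
for `s ≤ t`. -/
structure IsInhomogeneousPoisson {Ω : Type*} [MeasurableSpace Ω] (μ : Measure Ω)
    (N : ℝ≥0 → Ω → ℕ) (lam : ℝ → ℝ) : Prop where
  intensity_nonneg : ∀ t, 0 ≤ t → 0 ≤ lam t
  intensity_integrable : ∀ t : ℝ, 0 ≤ t → IntervalIntegrable lam volume 0 t
  zero : ∀ᵐ ω ∂μ, N 0 ω = 0
  indepIncrements : HasIndepIncrements N μ
  law_increment : ∀ s t : ℝ≥0, s ≤ t →
    HasLaw (fun ω => N t ω - N s ω)
      (poissonMeasure (cumIntensity lam t - cumIntensity lam s).toNNReal) μ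

/-- The law with density `lam(t) / m(T)` on `[0, T]`. -/
def arrivalLaw (lam : ℝ → ℝ) (T : ℝ) : Measure ℝ :=
  (volume.restrict (Set.Icc 0 T)).withDensity
    (fun t => ENNReal.ofReal (lam t / cumIntensity lam T))

/-- The shot noise process `Y(t) = ∑_{i=1}^{N(t)} X i * H i (t, τ i)` with random shock functions
`H i`. -/
def shotNoise {Ω : Type*} (X : ℕ → Ω → ℝ) (H : ℕ → Ω → ℝ → ℝ → ℝ) (τ : ℕ → Ω → ℝ≥0∞)
    (t : ℝ≥0) (ω : Ω) : ℝ :=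
  ∑ i ∈ Finset.Icc 1 (arrivalCount τ t ω), X i ω * H i ω t (τ i ω).toReal

/-- The finite-time ruin probability `ψ(x, T) = ℙ(sup_{0 ≤ t ≤ T} Y(t) > x)`, where the supremum
is taken in the extended reals. -/
def ruinProb {Ω : Type*} [MeasurableSpace Ω] (μ : Measure Ω) (Y : ℝ≥0 → Ω → ℝ)
    (x : ℝ) (T : ℝ≥0) : ℝ :=
  μ.real {ω | (x : EReal) < ⨆ t ∈ Set.Icc (0 : ℝ≥0) T, (Y t ω : EReal)}

end

/-!
The proof is the principle of a single large jump. Let `N` be the number of arrivals up to `T`, let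
`Θ i = h (ξ i) (τ i) (τ i)` be the initial value of the `i`-th shock function, and `F` the tail
of `X 1`. Since the shock functions are non-increasing, the supremum of the shot noise over `[0, T]`
lies between `max_{i ≤ N} X i Θ i` and `∑_{i ≤ N} X i Θ i`. Both have tail asymptotic to
`F x * 𝔼[∑_{i ≤ N} Θ i ^ α]`, and this expectation is `m(T) 𝔼[h₀(V₀, V₀) ^ α]`.

* *Expected number of large terms.* By independence `∑ i, ℙ(i ≤ N, X i Θ i > x)` is the mean of
  `∑_{i ≤ N} F (x / Θ i)`, a sum over marked arrivals. Campbell's formula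
  (`lintegral_pow_mul_sum_marked`) turns it into `m(T) 𝔼[F (x / h₀(V₀, V₀))]`, and Breiman's lemma
  (`RegularlyVarying.tendsto_lintegral_scaledTail`), that is, dominated convergence under Potter's
  bound, gives its order.
* *Two large terms are negligible.* The only other way for the sum to exceed `x` is that two terms
  exceed `δ x / N` (`exists_two_large_of_lt_sum`); also, the tail of the maximum
  falls short of the union bound by at most the sum over the pairs of the probabilities that both
  terms exceed `x` (`tsum_measure_le_measure_iUnion_add`). Given
  the weights, tail independence makes the contribution of each pair `o(F x)`. Summed over all
  pairs it is still `o(F x)` (`tendsto_tsum_measure_twoLargeTerms`), by dominated convergence: by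
  Potter's bound the sum is at most `F x` times `∑_{i ≤ N} (1 + Θ i ^ p)` times a power of `N`.

The number of terms is random and depends on the weights, so the dominating function needs a joint
moment of `N` and the `Θ i`. It is at most a constant times `2 ^ N ∑_{i ≤ N} (1 + Θ i ^ p)`, and
such exponentially weighted sums are as easy as unweighted ones: `2 ^ N(T)` factors over independent
increments, so Campbell's formula with weight `c ^ N(T)` needs only the increments over `[0, t]` and
`[t, T]`, and neither the order statistics property nor the Palm theory of the Poisson process.
-/

/-! ### Regularly varying tails -/

theorem RegularlyVarying.pos {f : ℝ → ℝ} {ρ : ℝ} (hf : RegularlyVarying f ρ) (hanti : Antitone f)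
    (hnn : ∀ x, 0 ≤ f x) (x : ℝ) : 0 < f x := by
  have h1 := hf 1 one_pos
  rw [Real.one_rpow] at h1
  obtain ⟨y, hy, hxy⟩ :=
    ((h1.eventually (lt_mem_nhds one_half_lt_one)).and (eventually_ge_atTop x)).exists
  have hy0 : f y ≠ 0 := by
    intro h0
    rw [h0, div_zero] at hy
    norm_num at hy
  exact (lt_of_le_of_ne (hnn y) hy0.symm).trans_le (hanti hxy)

/-- Potter's bound: a regularly varying tail of index `-α` satisfies, for `p > α` and large `x`,
`f (x / y) ≤ C (1 + y ^ p) f x` uniformly in `y > 0`. For `x / y` small the bound holds because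
`x ^ p * f x` is bounded away from zero. -/
theorem RegularlyVarying.potter {f : ℝ → ℝ} {α p : ℝ} (hf : RegularlyVarying f (-α))
    (hanti : Antitone f) (hnn : ∀ x, 0 ≤ f x) (hle : ∀ x, f x ≤ 1) (hp : α < p) (hp0 : 0 < p) :
    ∃ C x₀ : ℝ, 0 < C ∧ 0 < x₀ ∧ ∀ x, x₀ ≤ x → ∀ y, 0 < y →
      f (x / y) ≤ C * (1 + y ^ p) * f x := by
  have hpos := hf.pos hanti hnn
  have h2 := hf 2 two_pos
  have hlt : (2 : ℝ) ^ (-p) < 2 ^ (-α) :=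
    Real.rpow_lt_rpow_of_exponent_lt one_lt_two (by linarith)
  obtain ⟨a, ha⟩ := eventually_atTop.1 (h2.eventually (lt_mem_nhds hlt))
  obtain ⟨x₀, hx₀, hx₀1⟩ : ∃ x₀, a ≤ x₀ ∧ (1 : ℝ) ≤ x₀ := ⟨max a 1, le_max_left _ _, le_max_right _ _⟩
  have hstep : ∀ x, x₀ ≤ x → f x ≤ 2 ^ p * f (2 * x) := by
    intro x hx
    have h := ha x (hx₀.trans hx)
    rw [lt_div_iff₀ (hpos x), Real.rpow_neg two_pos.le, inv_mul_lt_iff₀ (by positivity)] at h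
    exact h.le
  have hiter : ∀ k : ℕ, ∀ x, x₀ ≤ x → f x ≤ (2 ^ p) ^ k * f (2 ^ k * x) := by
    intro k
    induction k with
    | zero => intro x _; simp
    | succ k ih =>
      intro x hx
      have hk : x₀ ≤ 2 ^ k * x :=
        hx.trans (le_mul_of_one_le_left (by linarith) (one_le_pow₀ one_le_two))
      calc f x ≤ (2 ^ p) ^ k * f (2 ^ k * x) := ih x hx
        _ ≤ (2 ^ p) ^ k * (2 ^ p * f (2 * (2 ^ k * x))) := by gcongr; exact hstep _ hk
        _ = (2 ^ p) ^ (k + 1) * f (2 ^ (k + 1) * x) := by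
          rw [show 2 * (2 ^ k * x) = 2 ^ (k + 1) * x by ring]; ring
  have hmul : ∀ x, x₀ ≤ x → ∀ y, 1 ≤ y → f x ≤ 2 ^ p * y ^ p * f (y * x) := by
    intro x hx y hy
    obtain ⟨k, hk1, hk2⟩ := exists_nat_pow_near hy one_lt_two
    calc f x ≤ (2 ^ p) ^ (k + 1) * f (2 ^ (k + 1) * x) := hiter _ x hx
      _ ≤ (2 ^ p) ^ (k + 1) * f (y * x) := by
        gcongr
        exact hanti (mul_le_mul_of_nonneg_right hk2.le (by linarith))
      _ = 2 ^ p * (2 ^ k) ^ p * f (y * x) := by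
        rw [pow_succ, ← Real.rpow_natCast, ← Real.rpow_natCast, ← Real.rpow_mul two_pos.le,
          ← Real.rpow_mul two_pos.le, mul_comm p]
        ring
      _ ≤ 2 ^ p * y ^ p * f (y * x) := by
        have := hnn (y * x)
        gcongr
  refine ⟨2 ^ p * (1 + 1 / f x₀), x₀, by have := hpos x₀; positivity, by linarith, ?_⟩
  intro x hx y hy
  have hx0 : 0 < x := by linarith
  have hfx := hpos x
  have hf0 := hpos x₀
  have h2p : (1 : ℝ) ≤ 2 ^ p := Real.one_le_rpow one_le_two hp0.le
  have hyp : 0 ≤ y ^ p := Real.rpow_nonneg hy.le _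
  rcases le_total y 1 with hy1 | hy1
  · have hxy : f (x / y) ≤ f x := hanti (le_div_self hx0.le hy hy1)
    have hc : 1 ≤ 2 ^ p * (1 + 1 / f x₀) * (1 + y ^ p) := by
      have h1 : 1 ≤ 1 + 1 / f x₀ := by have : 0 < 1 / f x₀ := by positivity
                                       linarith
      exact one_le_mul_of_one_le_of_one_le (one_le_mul_of_one_le_of_one_le h2p h1) (by linarith)
    exact hxy.trans (le_mul_of_one_le_left hfx.le hc)
  · rcases le_total x₀ (x / y) with h | h
    · have := hmul _ h y hy1
      rw [mul_div_cancel₀ _ hy.ne'] at this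
      refine this.trans ?_
      gcongr
      · exact le_mul_of_one_le_right (by positivity) (by have : 0 < 1 / f x₀ := by positivity
                                                         linarith)
      · linarith
    · have h1 := hmul x₀ le_rfl (x / x₀) ((one_le_div (by linarith)).2 hx)
      rw [div_mul_cancel₀ _ (by linarith)] at h1
      have hxy : x / x₀ ≤ y := by
        rw [div_le_iff₀ hy] at h
        rw [div_le_iff₀ (by linarith)]
        linarith
      have h2 : f x₀ ≤ 2 ^ p * y ^ p * f x := by
        refine h1.trans ?_
        gcongr
      calc f (x / y) ≤ 1 := hle _
        _ = (1 / f x₀) * f x₀ := by field_simp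
        _ ≤ (1 / f x₀) * (2 ^ p * y ^ p * f x) := by gcongr
        _ ≤ 2 ^ p * (1 + 1 / f x₀) * (1 + y ^ p) * f x := by
          have : 2 ^ p * (1 + 1 / f x₀) * (1 + y ^ p) * f x - (1 / f x₀) * (2 ^ p * y ^ p * f x)
              = 2 ^ p * f x * (1 + 1 / f x₀ + y ^ p) := by ring
          have h3 : 0 ≤ 2 ^ p * f x * (1 + 1 / f x₀ + y ^ p) := by positivity
          linarith

/-- Along `x / y` with `y > 0` fixed, a regularly varying function of index `-α` is
asymptotically `y ^ α` times its value at `x`. -/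
theorem RegularlyVarying.tendsto_div {f : ℝ → ℝ} {α : ℝ} (hf : RegularlyVarying f (-α)) {y : ℝ}
    (hy : 0 < y) : Tendsto (fun x => f (x / y) / f x) atTop (𝓝 (y ^ α)) := by
  have h := hf y⁻¹ (inv_pos.2 hy)
  rw [Real.inv_rpow hy.le, Real.rpow_neg hy.le, inv_inv] at h
  simpa only [div_eq_inv_mul] using h

section Tail

variable {Ω : Type*} [MeasurableSpace Ω] {μ : Measure Ω}

theorem tail_nonneg (Z : Ω → ℝ) (x : ℝ) : 0 ≤ tail μ Z x := measureReal_nonneg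

theorem ProbabilityTheory.IdentDistrib.tail_eq {Z Z' : Ω → ℝ} (h : IdentDistrib Z Z' μ μ) (x : ℝ) :
    tail μ Z x = tail μ Z' x := by
  simp only [tail, Measure.real]
  congr 1
  exact h.measure_mem_eq measurableSet_Ioi

/-- The joint tail `x ↦ ℙ(Z > x, Z' > x)` of two real random variables. -/
def jointTail (μ : Measure Ω) (Z Z' : Ω → ℝ) (x : ℝ) : ℝ :=
  μ.real {ω | x < Z ω ∧ x < Z' ω}

theorem jointTail_nonneg (Z Z' : Ω → ℝ) (x : ℝ) : 0 ≤ jointTail μ Z Z' x := measureReal_nonneg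

variable [IsProbabilityMeasure μ]

theorem tail_antitone (Z : Ω → ℝ) : Antitone (tail μ Z) := fun _ _ hxy =>
  measureReal_mono fun _ hω => lt_of_le_of_lt hxy hω

theorem tail_le_one (Z : Ω → ℝ) (x : ℝ) : tail μ Z x ≤ 1 := measureReal_le_one

theorem ofReal_tail (Z : Ω → ℝ) (x : ℝ) : ENNReal.ofReal (tail μ Z x) = μ {ω | x < Z ω} :=
  ofReal_measureReal

theorem jointTail_antitone (Z Z' : Ω → ℝ) : Antitone (jointTail μ Z Z') := fun _ _ hxy =>
  measureReal_mono fun _ hω => ⟨lt_of_le_of_lt hxy hω.1, lt_of_le_of_lt hxy hω.2⟩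

theorem jointTail_le_tail (Z Z' : Ω → ℝ) (x : ℝ) : jointTail μ Z Z' x ≤ tail μ Z x :=
  measureReal_mono fun _ hω => hω.1

theorem UniformTailIndependent.tendsto_jointTail {X : ℕ → Ω → ℝ}
    (hident : ∀ i, IdentDistrib (X i) (X 1) μ μ) (h : UniformTailIndependent μ X) {i j : ℕ}
    (hi : 1 ≤ i) (hj : 1 ≤ j) (hij : i ≠ j) :
    Tendsto (fun x => jointTail μ (X i) (X j) x / tail μ (X 1) x) atTop (𝓝 0) := by
  refine squeeze_zero (fun x => div_nonneg (jointTail_nonneg _ _ _) (tail_nonneg _ _)) (fun x => ?_) h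
  refine le_ciSup (f := fun p : {p : ℕ × ℕ // 1 ≤ p.1 ∧ 1 ≤ p.2 ∧ p.1 ≠ p.2} =>
      μ.real {ω | x < X p.1.1 ω ∧ x < X p.1.2 ω} / tail μ (X 1) x) ?_ ⟨(i, j), hi, hj, hij⟩
  refine ⟨1, ?_⟩
  rintro _ ⟨p, rfl⟩
  refine div_le_one_of_le₀ ?_ (tail_nonneg _ _)
  rw [← (hident p.1.1).tail_eq]
  exact jointTail_le_tail _ _ _

end Tail

/-! ### Integrals of functions of independent variables -/

theorem ProbabilityTheory.IndepFun.lintegral_pair {Ω β γ : Type*} [MeasurableSpace Ω]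
    [MeasurableSpace β] [MeasurableSpace γ] {μ : Measure Ω} [IsProbabilityMeasure μ] {Y : Ω → β}
    {W : Ω → γ} (hYW : IndepFun Y W μ) (hY : AEMeasurable Y μ) (hW : AEMeasurable W μ)
    {f : β × γ → ℝ≥0∞} (hf : Measurable f) :
    ∫⁻ ω, f (Y ω, W ω) ∂μ = ∫⁻ ω, ∫⁻ ω', f (Y ω', W ω) ∂μ ∂μ := by
  have := Measure.isProbabilityMeasure_map hY
  have := Measure.isProbabilityMeasure_map hW
  rw [← lintegral_map' hf.aemeasurable (hY.prodMk hW),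
    (indepFun_iff_map_prod_eq_prod_map_map hY hW).1 hYW, lintegral_prod_symm _ hf.aemeasurable,
    lintegral_map' hf.lintegral_prod_left'.aemeasurable hW]
  refine lintegral_congr fun ω => ?_
  rw [lintegral_map' (by fun_prop) hY]

theorem ProbabilityTheory.IdentDistrib.lintegral_comp {Ω Ω' β : Type*} [MeasurableSpace Ω]
    [MeasurableSpace Ω'] [MeasurableSpace β] {μ : Measure Ω} {ν : Measure Ω'} {Y : Ω → β}
    {Z : Ω' → β} (h : IdentDistrib Y Z μ ν) {f : β → ℝ≥0∞} (hf : Measurable f) :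
    ∫⁻ ω, f (Y ω) ∂μ = ∫⁻ ω, f (Z ω) ∂ν :=
  (h.comp hf).lintegral_eq

/-- Tonelli's theorem for a sum over a random range `1, …, N`. -/
theorem lintegral_sum_Icc {Ω : Type*} [MeasurableSpace Ω] {μ : Measure Ω} {N : Ω → ℕ}
    (hN : Measurable N) {f : ℕ → Ω → ℝ≥0∞} (hf : ∀ i, Measurable (f i)) :
    ∫⁻ ω, ∑ i ∈ Finset.Icc 1 (N ω), f i ω ∂μ
      = ∑' i, ∫⁻ ω in {ω | i ∈ Finset.Icc 1 (N ω)}, f i ω ∂μ := by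
  have hs : ∀ i, MeasurableSet {ω | i ∈ Finset.Icc 1 (N ω)} := fun i =>
    hN (MeasurableSet.of_discrete (s := {n | i ∈ Finset.Icc 1 n}))
  simp_rw [← lintegral_indicator (hs _)]
  rw [← lintegral_tsum fun i => ((hf i).indicator (hs i)).aemeasurable]
  refine lintegral_congr fun ω => ?_
  rw [tsum_eq_sum (s := Finset.Icc 1 (N ω))]
  · refine Finset.sum_congr rfl fun i hi => ?_
    rw [Set.indicator_of_mem (by exact hi)]
  · intro i hi
    exact Set.indicator_of_notMem (s := {ω | i ∈ Finset.Icc 1 (N ω)}) hi _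

/-! ### The Poisson distribution -/

theorem lintegral_poissonMeasure (r : ℝ≥0) (f : ℕ → ℝ≥0∞) :
    ∫⁻ n, f n ∂poissonMeasure r
      = ∑' n : ℕ, ENNReal.ofReal (Real.exp (-r) * r ^ n / n.factorial) * f n := by
  simp [poissonMeasure, lintegral_sum_measure]

theorem lintegral_pow_poissonMeasure (r c : ℝ≥0) :
    ∫⁻ n, (c : ℝ≥0∞) ^ n ∂poissonMeasure r = ENNReal.ofReal (Real.exp ((c - 1) * r)) := by
  have hs : HasSum (fun n : ℕ => Real.exp (-r) * ((c * r : ℝ) ^ n / n.factorial))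
      (Real.exp ((c - 1) * r)) := by
    have h := (NormedSpace.expSeries_div_hasSum_exp (c * r : ℝ)).mul_left (Real.exp (-r))
    rwa [← Real.exp_eq_exp_ℝ, ← Real.exp_add, show -(r : ℝ) + c * r = (c - 1) * r by ring] at h
  rw [lintegral_poissonMeasure, ← hs.tsum_eq,
    ENNReal.ofReal_tsum_of_nonneg (fun n => by positivity) hs.summable]
  refine tsum_congr fun n => ?_
  rw [← ENNReal.ofReal_coe_nnreal, ← ENNReal.ofReal_pow (by positivity),
    ← ENNReal.ofReal_mul (by positivity)]
  congr 1
  rw [mul_pow]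
  ring

theorem lintegral_pow_mul_poissonMeasure (r c : ℝ≥0) :
    ∫⁻ n, (c : ℝ≥0∞) ^ n * n ∂poissonMeasure r
      = c * r * ENNReal.ofReal (Real.exp ((c - 1) * r)) := by
  rw [← lintegral_pow_poissonMeasure, lintegral_poissonMeasure, lintegral_poissonMeasure,
    tsum_eq_zero_add' ENNReal.summable, ← ENNReal.tsum_mul_left]
  simp only [Nat.cast_zero, mul_zero, zero_add]
  refine tsum_congr fun n => ?_
  rw [← ENNReal.ofReal_coe_nnreal (p := c), ← ENNReal.ofReal_coe_nnreal (p := r),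
    ← ENNReal.ofReal_natCast (n + 1), ← ENNReal.ofReal_pow (by positivity),
    ← ENNReal.ofReal_pow (by positivity), ← ENNReal.ofReal_mul (by positivity),
    ← ENNReal.ofReal_mul (by positivity), ← ENNReal.ofReal_mul (by positivity),
    ← ENNReal.ofReal_mul (by positivity), ← ENNReal.ofReal_mul (by positivity)]
  congr 1
  rw [Nat.factorial_succ]
  push_cast
  field_simp
  ring

/-! ### Arrival sequences and their counting process -/

section Arrival

variable {Ω : Type*} [MeasurableSpace Ω] {τ : ℕ → Ω → ℝ≥0∞}

theorem IsArrivalSequence.setOf_le_eq (hτ : IsArrivalSequence τ) (t : ℝ≥0) (ω : Ω) :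
    {i : ℕ | 1 ≤ i ∧ τ i ω ≤ t} = Set.Icc 1 (arrivalCount τ t ω) := by
  have hfin := hτ.locallyFinite ω t
  ext i
  simp only [Set.mem_ofPred_eq, Set.mem_Icc]
  constructor
  · rintro ⟨hi, hit⟩
    refine ⟨hi, ?_⟩
    have hsub : Set.Icc 1 i ⊆ {i : ℕ | 1 ≤ i ∧ τ i ω ≤ t} := fun j hj =>
      ⟨hj.1, (hτ.mono ω j i hj.1 hj.2).trans hit⟩
    have := Set.ncard_le_ncard hsub hfin
    rwa [show (Set.Icc 1 i).ncard = i by simp [Set.ncard_eq_toFinset_card']] at this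
  · rintro ⟨hi, hiN⟩
    refine ⟨hi, ?_⟩
    by_contra hcon
    have hsub : {i : ℕ | 1 ≤ i ∧ τ i ω ≤ t} ⊆ Set.Icc 1 (i - 1) := by
      rintro j ⟨hj, hjt⟩
      refine ⟨hj, ?_⟩
      by_contra hji
      exact hcon ((hτ.mono ω i j hi (by omega)).trans hjt)
    have h := Set.ncard_le_ncard hsub (Set.finite_Icc _ _)
    have h' : (Set.Icc 1 (i - 1)).ncard = i - 1 := by simp [Set.ncard_eq_toFinset_card']
    rw [h'] at h
    have : arrivalCount τ t ω ≤ i - 1 := h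
    omega

theorem IsArrivalSequence.le_iff (hτ : IsArrivalSequence τ) {t : ℝ≥0} {ω : Ω} {i : ℕ} :
    i ∈ Finset.Icc 1 (arrivalCount τ t ω) ↔ 1 ≤ i ∧ τ i ω ≤ t := by
  have h := Set.ext_iff.1 (hτ.setOf_le_eq t ω) i
  rw [Finset.mem_Icc]
  exact h.symm

theorem IsArrivalSequence.arrivalCount_mono (hτ : IsArrivalSequence τ) (ω : Ω) :
    Monotone fun t => arrivalCount τ t ω := by
  intro s t hst
  refine Set.ncard_le_ncard (fun i hi => ⟨hi.1, hi.2.trans ?_⟩) (hτ.locallyFinite ω t)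
  exact_mod_cast hst

theorem IsArrivalSequence.measurable_arrivalCount (hτ : IsArrivalSequence τ) (t : ℝ≥0) :
    Measurable (arrivalCount τ t) := by
  refine measurable_of_Ici fun k => ?_
  rcases Nat.eq_zero_or_pos k with rfl | hk
  · simp
  · have : arrivalCount τ t ⁻¹' Set.Ici k = {ω | τ k ω ≤ t} := by
      ext ω
      have := hτ.le_iff (t := t) (ω := ω) (i := k)
      simp only [Finset.mem_Icc] at this
      simp only [Set.mem_preimage, Set.mem_Ici, Set.mem_ofPred_eq]
      tauto
    rw [this]
    exact measurableSet_le (hτ.measurable k) measurable_const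

/-- The number of arrivals is a measurable function of the sequence of arrival times. -/
theorem IsArrivalSequence.exists_measurable_comp (hτ : IsArrivalSequence τ) (t : ℝ≥0) :
    ∃ φ : (ℕ → ℝ≥0∞) → ℕ, Measurable φ ∧ ∀ ω, arrivalCount τ t ω = φ (fun i => τ i ω) := by
  let π : Ω → ℕ → ℝ≥0∞ := fun ω i => τ i ω
  have h : @IsArrivalSequence Ω (MeasurableSpace.comap π inferInstance) τ :=
    @IsArrivalSequence.mk Ω (MeasurableSpace.comap π inferInstance) τ
      (fun i => (measurable_pi_apply i).comp (comap_measurable π)) hτ.mono hτ.locallyFinite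
  have hm := @IsArrivalSequence.measurable_arrivalCount Ω (MeasurableSpace.comap π inferInstance)
    τ h t
  obtain ⟨φ, hφ, hφe⟩ := hm.exists_eq_measurable_comp
  exact ⟨φ, hφ, fun ω => congrFun hφe ω⟩

theorem IsArrivalSequence.filter_le_eq (hτ : IsArrivalSequence τ) {s t : ℝ≥0} (hst : s ≤ t)
    (ω : Ω) : (Finset.Icc 1 (arrivalCount τ t ω)).filter (fun i => (τ i ω).toReal ≤ s)
      = Finset.Icc 1 (arrivalCount τ s ω) := by
  ext i
  rw [Finset.mem_filter, hτ.le_iff, hτ.le_iff]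
  constructor
  · rintro ⟨⟨hi, hit⟩, his⟩
    refine ⟨hi, ?_⟩
    rw [← ENNReal.ofReal_toReal (hit.trans_lt ENNReal.coe_lt_top).ne, ← ENNReal.ofReal_coe_nnreal]
    exact ENNReal.ofReal_le_ofReal his
  · rintro ⟨hi, his⟩
    refine ⟨⟨hi, his.trans (by exact_mod_cast hst)⟩, ?_⟩
    have := ENNReal.toReal_mono ENNReal.coe_ne_top his
    simpa using this

end Arrival

/-! ### Campbell's formula, weighted by the number of arrivals -/

section Campbell

variable {Ω : Type*} [MeasurableSpace Ω] {μ : Measure Ω} {lam : ℝ → ℝ} {τ : ℕ → Ω → ℝ≥0∞}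

theorem IsInhomogeneousPoisson.cumIntensity_mono {N : ℝ≥0 → Ω → ℕ}
    (hN : IsInhomogeneousPoisson μ N lam) {s t : ℝ} (hs : 0 ≤ s) (hst : s ≤ t) :
    cumIntensity lam s ≤ cumIntensity lam t := by
  refine intervalIntegral.integral_mono_interval le_rfl hs hst ?_
    (hN.intensity_integrable t (hs.trans hst))
  filter_upwards [ae_restrict_mem measurableSet_Ioc] with u hu using hN.intensity_nonneg u hu.1.le

theorem IsInhomogeneousPoisson.setLIntegral_Icc {N : ℝ≥0 → Ω → ℕ}
    (hN : IsInhomogeneousPoisson μ N lam) {t : ℝ} (ht : 0 ≤ t) :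
    ∫⁻ s in Set.Icc 0 t, ENNReal.ofReal (lam s) = ENNReal.ofReal (cumIntensity lam t) := by
  rw [cumIntensity, intervalIntegral.integral_of_le ht, ← restrict_Ioc_eq_restrict_Icc,
    ofReal_integral_eq_lintegral_ofReal]
  · exact (intervalIntegrable_iff_integrableOn_Ioc_of_le ht).1 (hN.intensity_integrable t ht)
  · filter_upwards [ae_restrict_mem measurableSet_Ioc] with u hu using hN.intensity_nonneg u hu.1.le

/-- `𝔼[c ^ N(T) N(t)] = c m(t) exp ((c - 1) m(T))` for `t ≤ T`, since `c ^ N(T)` is the product of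
the independent variables `c ^ N(t)` and `c ^ (N(T) - N(t))`. -/
theorem lintegral_pow_arrivalCount_mul [IsProbabilityMeasure μ] (hτ : IsArrivalSequence τ)
    (hN : IsInhomogeneousPoisson μ (arrivalCount τ) lam) (c : ℝ≥0) {t T : ℝ≥0} (htT : t ≤ T) :
    ∫⁻ ω, (c : ℝ≥0∞) ^ arrivalCount τ T ω * arrivalCount τ t ω ∂μ
      = c * ENNReal.ofReal (Real.exp ((c - 1) * cumIntensity lam T))
        * ENNReal.ofReal (cumIntensity lam t) := by
  have hind : IndepFun (fun ω => arrivalCount τ t ω - arrivalCount τ 0 ω)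
      (fun ω => arrivalCount τ T ω - arrivalCount τ t ω) μ :=
    hN.indepIncrements.indepFun_sub_sub zero_le htT
  have hm0 : cumIntensity lam 0 = 0 := by simp [cumIntensity]
  have hmt : 0 ≤ cumIntensity lam t := by
    simpa [hm0] using hN.cumIntensity_mono le_rfl t.2
  have hmT : 0 ≤ cumIntensity lam T - cumIntensity lam t :=
    sub_nonneg.2 (hN.cumIntensity_mono t.2 (by exact_mod_cast htT))
  have hmeas := hτ.measurable_arrivalCount
  calc ∫⁻ ω, (c : ℝ≥0∞) ^ arrivalCount τ T ω * arrivalCount τ t ω ∂μ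
      = ∫⁻ ω, ((c : ℝ≥0∞) ^ (arrivalCount τ t ω - arrivalCount τ 0 ω)
          * ((arrivalCount τ t ω - arrivalCount τ 0 ω : ℕ) : ℝ≥0∞))
          * (c : ℝ≥0∞) ^ (arrivalCount τ T ω - arrivalCount τ t ω) ∂μ := by
        refine lintegral_congr_ae ?_
        filter_upwards [hN.zero] with ω hω
        have hle : arrivalCount τ t ω ≤ arrivalCount τ T ω := hτ.arrivalCount_mono ω htT
        rw [hω, Nat.sub_zero, mul_right_comm, ← pow_add, Nat.add_sub_cancel' hle]
    _ = (∫⁻ ω, (c : ℝ≥0∞) ^ (arrivalCount τ t ω - arrivalCount τ 0 ω)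
          * ((arrivalCount τ t ω - arrivalCount τ 0 ω : ℕ) : ℝ≥0∞) ∂μ)
          * ∫⁻ ω, (c : ℝ≥0∞) ^ (arrivalCount τ T ω - arrivalCount τ t ω) ∂μ := by
        refine lintegral_mul_eq_lintegral_mul_lintegral_of_indepFun'' ?_ ?_
          (hind.comp (φ := fun n : ℕ => (c : ℝ≥0∞) ^ n * n) (ψ := fun n : ℕ => (c : ℝ≥0∞) ^ n)
            .of_discrete .of_discrete)
        · exact (Measurable.of_discrete (f := fun n : ℕ => (c : ℝ≥0∞) ^ n * n)).comp_aemeasurable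
            ((hmeas t).sub (hmeas 0)).aemeasurable
        · exact (Measurable.of_discrete (f := fun n : ℕ => (c : ℝ≥0∞) ^ n)).comp_aemeasurable
            ((hmeas T).sub (hmeas t)).aemeasurable
    _ = _ := by
        have h1 := (hN.law_increment 0 t zero_le).lintegral_comp
          (f := fun n : ℕ => (c : ℝ≥0∞) ^ n * n) Measurable.of_discrete.aemeasurable
        have h2 := (hN.law_increment t T htT).lintegral_comp
          (f := fun n : ℕ => (c : ℝ≥0∞) ^ n) Measurable.of_discrete.aemeasurable
        rw [h1, h2, lintegral_pow_mul_poissonMeasure, lintegral_pow_poissonMeasure,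
          NNReal.coe_zero, hm0, sub_zero, Real.coe_toNNReal _ hmT, Real.coe_toNNReal _ hmt, mul_assoc,
          ← ENNReal.ofReal_mul (Real.exp_pos _).le, ← Real.exp_add, mul_right_comm,
          show (c - 1) * cumIntensity lam t + (c - 1) * (cumIntensity lam T - cumIntensity lam t)
            = (c - 1) * cumIntensity lam T by ring]
        rfl

/-- The mean measure of the arrivals in `[0, T]`, weighted by `c ^ N(T)`: it gives a set `B` of
times the mass `𝔼[c ^ N(T) #{i : τ i ∈ B, τ i ≤ T}]`. -/
noncomputable def arrivalMeanMeasure (μ : Measure Ω) (τ : ℕ → Ω → ℝ≥0∞) (T : ℝ≥0) (c : ℝ≥0) : Measure ℝ :=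
  Measure.sum fun i =>
    ((μ.withDensity fun ω => (c : ℝ≥0∞) ^ arrivalCount τ T ω).restrict
      {ω | i ∈ Finset.Icc 1 (arrivalCount τ T ω)}).map fun ω => (τ i ω).toReal

theorem lintegral_arrivalMeanMeasure (hτ : IsArrivalSequence τ) (T c : ℝ≥0) {g : ℝ → ℝ≥0∞}
    (hg : Measurable g) :
    ∫⁻ s, g s ∂arrivalMeanMeasure μ τ T c
      = ∫⁻ ω, ∑ i ∈ Finset.Icc 1 (arrivalCount τ T ω),
          (c : ℝ≥0∞) ^ arrivalCount τ T ω * g (τ i ω).toReal ∂μ := by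
  have hmeas := hτ.measurable_arrivalCount T
  have hc : Measurable fun ω => (c : ℝ≥0∞) ^ arrivalCount τ T ω :=
    (Measurable.of_discrete (f := fun n : ℕ => (c : ℝ≥0∞) ^ n)).comp hmeas
  have hgi : ∀ i, Measurable fun ω => g (τ i ω).toReal := fun i =>
    hg.comp (hτ.measurable i).ennreal_toReal
  rw [lintegral_sum_Icc (f := fun i ω => (c : ℝ≥0∞) ^ arrivalCount τ T ω * g (τ i ω).toReal) hmeas
    fun i => hc.mul (hgi i), arrivalMeanMeasure, lintegral_sum_measure]
  refine tsum_congr fun i => ?_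
  have hs : MeasurableSet {ω | i ∈ Finset.Icc 1 (arrivalCount τ T ω)} :=
    hmeas (MeasurableSet.of_discrete (s := {n | i ∈ Finset.Icc 1 n}))
  rw [lintegral_map hg (hτ.measurable i).ennreal_toReal, restrict_withDensity hs,
    lintegral_withDensity_eq_lintegral_mul _ hc (hgi i)]
  rfl

theorem arrivalMeanMeasure_eq [IsProbabilityMeasure μ] (hτ : IsArrivalSequence τ)
    (hN : IsInhomogeneousPoisson μ (arrivalCount τ) lam) (T c : ℝ≥0) :
    arrivalMeanMeasure μ τ T c
      = (c * ENNReal.ofReal (Real.exp ((c - 1) * cumIntensity lam T))) •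
        (volume.restrict (Set.Icc 0 (T : ℝ))).withDensity fun s => ENNReal.ofReal (lam s) := by
  set K : ℝ≥0∞ := c * ENNReal.ofReal (Real.exp ((c - 1) * cumIntensity lam T)) with hK
  have hKtop : K ≠ ∞ := ENNReal.mul_ne_top ENNReal.coe_ne_top ENNReal.ofReal_ne_top
  have key : ∀ t : ℝ≥0, t ≤ T →
      arrivalMeanMeasure μ τ T c (Set.Iic (t : ℝ)) = K * ENNReal.ofReal (cumIntensity lam t) := by
    intro t htT
    rw [← lintegral_indicator_one measurableSet_Iic, lintegral_arrivalMeanMeasure hτ T c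
      (measurable_one.indicator measurableSet_Iic), hK,
      ← lintegral_pow_arrivalCount_mul hτ hN c htT]
    refine lintegral_congr fun ω => ?_
    rw [← Finset.mul_sum]
    congr 1
    simp only [Set.indicator_apply, Set.mem_Iic, Pi.one_apply]
    rw [Finset.sum_boole, hτ.filter_le_eq htT]
    simp
  -- every counted arrival is at most `T`, so the mass lies in `(-∞, T]`
  have hsupp : ∀ a : ℝ, 0 ≤ a → arrivalMeanMeasure μ τ T c (Set.Iic a)
      = arrivalMeanMeasure μ τ T c (Set.Iic (min a T)) := by
    intro a _
    rw [← lintegral_indicator_one measurableSet_Iic, ← lintegral_indicator_one measurableSet_Iic,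
      lintegral_arrivalMeanMeasure hτ T c (measurable_one.indicator measurableSet_Iic),
      lintegral_arrivalMeanMeasure hτ T c (measurable_one.indicator measurableSet_Iic)]
    refine lintegral_congr fun ω => Finset.sum_congr rfl fun i hi => ?_
    have hiT : (τ i ω).toReal ≤ T := by
      have := ENNReal.toReal_mono ENNReal.coe_ne_top (hτ.le_iff.1 hi).2
      simpa using this
    simp [Set.indicator_apply, hiT]
  have huniv : arrivalMeanMeasure μ τ T c Set.univ
      = arrivalMeanMeasure μ τ T c (Set.Iic (T : ℝ)) := by
    rw [← lintegral_indicator_one MeasurableSet.univ, ← lintegral_indicator_one measurableSet_Iic,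
      lintegral_arrivalMeanMeasure hτ T c (measurable_one.indicator MeasurableSet.univ),
      lintegral_arrivalMeanMeasure hτ T c (measurable_one.indicator measurableSet_Iic)]
    refine lintegral_congr fun ω => Finset.sum_congr rfl fun i hi => ?_
    have hiT : (τ i ω).toReal ≤ T := by
      have := ENNReal.toReal_mono ENNReal.coe_ne_top (hτ.le_iff.1 hi).2
      simpa using this
    simp [hiT]
  have hfin : IsFiniteMeasure (arrivalMeanMeasure μ τ T c) := by
    refine ⟨?_⟩
    rw [huniv, key T le_rfl]
    exact (ENNReal.mul_ne_top hKtop ENNReal.ofReal_ne_top).lt_top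
  refine Measure.ext_of_Iic _ _ fun a => ?_
  rw [Measure.smul_apply, withDensity_apply _ measurableSet_Iic,
    Measure.restrict_restrict measurableSet_Iic, smul_eq_mul]
  rcases lt_or_ge a 0 with ha | ha
  · have h1 : Set.Iic a ∩ Set.Icc 0 (T : ℝ) = ∅ := by
      ext u
      simp only [Set.mem_inter_iff, Set.mem_Iic, Set.mem_Icc, Set.mem_empty_iff_false, iff_false]
      rintro ⟨h, h', -⟩
      linarith
    rw [h1, Measure.restrict_empty, lintegral_zero_measure, mul_zero]
    -- there is no mass at `0` either, since `N(0) = 0` almost surely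
    have h0 := key 0 zero_le
    rw [NNReal.coe_zero, show cumIntensity lam 0 = 0 by simp [cumIntensity], ENNReal.ofReal_zero,
      mul_zero] at h0
    exact measure_mono_null (Set.Iic_subset_Iic.2 ha.le) h0
  · have hmin : 0 ≤ min a (T : ℝ) := le_min ha T.2
    have h1 : Set.Iic a ∩ Set.Icc 0 (T : ℝ) = Set.Icc 0 (min a T) := by
      ext u
      simp only [Set.mem_inter_iff, Set.mem_Iic, Set.mem_Icc, le_min_iff]
      tauto
    have h2 := key ⟨min a T, hmin⟩ (NNReal.coe_le_coe.1 (min_le_right _ _))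
    rw [h1, hN.setLIntegral_Icc hmin, hsupp a ha]
    exact h2

/-- Campbell's formula for marked arrivals, weighted by `c ^ N(T)`:
`𝔼[c ^ N(T) ∑_{i ≤ N(T)} g(ξ i, τ i)] = c exp ((c - 1) m(T)) m(T) 𝔼[g(ζ, V₀)]`. For `c = 1` it is
the usual formula for the mean; for `c > 1` it shows that the sums over the arrivals have moments
that survive multiplication by any power of the number of arrivals. -/
theorem lintegral_pow_mul_sum_marked [IsProbabilityMeasure μ] (hτ : IsArrivalSequence τ)
    (hN : IsInhomogeneousPoisson μ (arrivalCount τ) lam) {E : Type*} [MeasurableSpace E]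
    {ξ : ℕ → Ω → E} (hξ : ∀ i, Measurable (ξ i)) (hξ_ident : ∀ i, IdentDistrib (ξ i) (ξ 1) μ μ)
    (hind : IndepFun (fun ω i => ξ i ω) (fun ω i => τ i ω) μ) {T : ℝ≥0}
    {Ω' : Type*} [MeasurableSpace Ω'] {P : Measure Ω'} [IsProbabilityMeasure P]
    {ζ : Ω' → E} {V₀ : Ω' → ℝ} (hζ : IdentDistrib ζ (ξ 1) P μ)
    (hV₀ : HasLaw V₀ (arrivalLaw lam T) P) (hζV₀ : IndepFun ζ V₀ P)
    {g : E × ℝ → ℝ≥0∞} (hg : Measurable g) (c : ℝ≥0) :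
    ∫⁻ ω, ∑ i ∈ Finset.Icc 1 (arrivalCount τ T ω),
        (c : ℝ≥0∞) ^ arrivalCount τ T ω * g (ξ i ω, (τ i ω).toReal) ∂μ
      = c * ENNReal.ofReal (Real.exp ((c - 1) * cumIntensity lam T))
        * (ENNReal.ofReal (cumIntensity lam T) * ∫⁻ ω, g (ζ ω, V₀ ω) ∂P) := by
  have hmeas := hτ.measurable_arrivalCount T
  have hpow : Measurable fun n : ℕ => (c : ℝ≥0∞) ^ n := .of_discrete
  have hτi : ∀ i, Measurable fun ω => (τ i ω).toReal := fun i => (hτ.measurable i).ennreal_toReal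
  set G : ℝ → ℝ≥0∞ := fun s => ∫⁻ ω, g (ζ ω, s) ∂P with hG
  have hGmap : ∀ s, G s = ∫⁻ e, g (e, s) ∂(P.map ζ) := fun s =>
    (lintegral_map' (f := fun e => g (e, s)) (by fun_prop) hζ.aemeasurable_fst).symm
  have hGmeas : Measurable G := by
    have := Measure.isProbabilityMeasure_map hζ.aemeasurable_fst
    rw [funext hGmap]
    exact hg.lintegral_prod_left'
  obtain ⟨φ, hφ, hφe⟩ := hτ.exists_measurable_comp T
  have hterm : ∀ i, ∫⁻ ω in {ω | i ∈ Finset.Icc 1 (arrivalCount τ T ω)},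
      (c : ℝ≥0∞) ^ arrivalCount τ T ω * g (ξ i ω, (τ i ω).toReal) ∂μ
      = ∫⁻ ω in {ω | i ∈ Finset.Icc 1 (arrivalCount τ T ω)},
      (c : ℝ≥0∞) ^ arrivalCount τ T ω * G (τ i ω).toReal ∂μ := by
    intro i
    have hs : MeasurableSet {ω | i ∈ Finset.Icc 1 (arrivalCount τ T ω)} :=
      hmeas (MeasurableSet.of_discrete (s := {n | i ∈ Finset.Icc 1 n}))
    have hi : IndepFun (ξ i) (fun ω => (arrivalCount τ T ω, (τ i ω).toReal)) μ := by
      have h1 : Measurable fun w : ℕ → E => w i := measurable_pi_apply i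
      have h2 : Measurable fun w : ℕ → ℝ≥0∞ => (φ w, (w i).toReal) :=
        hφ.prodMk (measurable_pi_apply i).ennreal_toReal
      have h := hind.comp h1 h2
      have he : (fun w : ℕ → ℝ≥0∞ => (φ w, (w i).toReal)) ∘ (fun ω i => τ i ω)
          = fun ω => (arrivalCount τ T ω, (τ i ω).toReal) := by
        ext ω <;> simp [hφe]
      rwa [he] at h
    have hJ : Measurable fun n : ℕ => if i ∈ Finset.Icc 1 n then (c : ℝ≥0∞) ^ n else 0 :=
      .of_discrete
    have hf : Measurable fun q : E × ℕ × ℝ =>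
        (if i ∈ Finset.Icc 1 q.2.1 then (c : ℝ≥0∞) ^ q.2.1 else 0) * g (q.1, q.2.2) :=
      (hJ.comp (by fun_prop)).mul (hg.comp (by fun_prop))
    have h := hi.lintegral_pair (hξ i).aemeasurable (hmeas.prodMk (hτi i)).aemeasurable hf
    rw [← lintegral_indicator hs, ← lintegral_indicator hs]
    refine Eq.trans (lintegral_congr fun ω => ?_) (h.trans (lintegral_congr fun ω => ?_))
    · simp only [Set.indicator_apply, Set.mem_ofPred_eq]
      split_ifs <;> simp
    · change ∫⁻ ω', (if i ∈ Finset.Icc 1 (arrivalCount τ T ω) then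
        (c : ℝ≥0∞) ^ arrivalCount τ T ω else 0) * g (ξ i ω', (τ i ω).toReal) ∂μ = _
      rw [lintegral_const_mul _ (f := fun ω' => g (ξ i ω', (τ i ω).toReal))
          (hg.comp ((hξ i).prodMk measurable_const)),
        ((hξ_ident i).trans hζ.symm).lintegral_comp (f := fun e => g (e, (τ i ω).toReal))
          (by fun_prop)]
      simp only [Set.indicator_apply, Set.mem_ofPred_eq]
      split_ifs <;> simp [hG]
  -- if `m(T)` vanished, the density of `V₀` would be `lam / 0 = 0`, not a probability density
  have hm : 0 < cumIntensity lam T := by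
    by_contra hm
    have h0 : arrivalLaw lam T = 0 := by
      rw [arrivalLaw, withDensity_eq_zero_iff (by
        have h1 : AEMeasurable lam (volume.restrict (Set.Icc 0 (T : ℝ))) := by
          rw [← restrict_Ioc_eq_restrict_Icc]
          exact ((intervalIntegrable_iff_integrableOn_Ioc_of_le T.2).1
            (hN.intensity_integrable T T.2)).aestronglyMeasurable.aemeasurable
        fun_prop)]
      filter_upwards [ae_restrict_mem measurableSet_Icc] with s hs
      exact ENNReal.ofReal_eq_zero.2
        (div_nonpos_of_nonneg_of_nonpos (hN.intensity_nonneg s hs.1) (not_lt.1 hm))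
    have := Measure.isProbabilityMeasure_map hV₀.aemeasurable
    have h1 := this.measure_univ
    rw [hV₀.map_eq, h0, Measure.coe_zero, Pi.zero_apply] at h1
    exact zero_ne_one h1
  rw [lintegral_sum_Icc
      (f := fun i ω => (c : ℝ≥0∞) ^ arrivalCount τ T ω * g (ξ i ω, (τ i ω).toReal)) hmeas
      fun i => (hpow.comp hmeas).mul (hg.comp ((hξ i).prodMk (hτi i))),
    tsum_congr hterm,
    ← lintegral_sum_Icc
      (f := fun i ω => (c : ℝ≥0∞) ^ arrivalCount τ T ω * G (τ i ω).toReal) hmeas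
      fun i => (hpow.comp hmeas).mul (hGmeas.comp (hτi i)),
    ← lintegral_arrivalMeanMeasure hτ T c hGmeas, arrivalMeanMeasure_eq hτ hN,
    lintegral_smul_measure, smul_eq_mul]
  congr 1
  have hlaw : (volume.restrict (Set.Icc 0 (T : ℝ))).withDensity (fun s => ENNReal.ofReal (lam s))
      = ENNReal.ofReal (cumIntensity lam T) • arrivalLaw lam T := by
    rw [arrivalLaw, ← withDensity_smul' _ _ ENNReal.ofReal_ne_top]
    congr 1
    ext s
    rw [Pi.smul_apply, smul_eq_mul, ← ENNReal.ofReal_mul hm.le, mul_div_cancel₀ _ hm.ne']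
  rw [hlaw, lintegral_smul_measure, smul_eq_mul, ← hV₀.lintegral_comp hGmeas.aemeasurable,
    hζV₀.lintegral_pair hζ.aemeasurable_fst hV₀.aemeasurable hg]

end Campbell

/-! ### Tails of products with independent weights -/

/-- If `f` is the tail of `X ≥ 0`, then `scaledTail f x y` is `ℙ(X y > x)`, for `x > 0` and a
deterministic weight `y ≥ 0`. -/
noncomputable def scaledTail (f : ℝ → ℝ) (x y : ℝ) : ℝ := if 0 < y then f (x / y) else 0

theorem scaledTail_mono {f g : ℝ → ℝ} (hfg : ∀ x, f x ≤ g x) (x y : ℝ) :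
    scaledTail f x y ≤ scaledTail g x y := by
  unfold scaledTail
  split_ifs
  exacts [hfg _, le_rfl]

theorem Antitone.measurable_scaledTail {f : ℝ → ℝ} (hf : Antitone f) (x : ℝ) :
    Measurable (scaledTail f x) :=
  Measurable.ite measurableSet_Ioi (hf.measurable.comp (measurable_const.div measurable_id))
    measurable_const

theorem RegularlyVarying.exists_scaledTail_le {f : ℝ → ℝ} {α p : ℝ} (hf : RegularlyVarying f (-α))
    (hanti : Antitone f) (hnn : ∀ x, 0 ≤ f x) (hle : ∀ x, f x ≤ 1) (hp : α < p) (hp0 : 0 < p) :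
    ∃ C : ℝ, 0 < C ∧ ∀ᶠ x in atTop, ∀ y, 0 ≤ y →
      scaledTail f x y / f x ≤ C * (1 + y ^ p) := by
  obtain ⟨C, x₀, hC, -, h⟩ := hf.potter hanti hnn hle hp hp0
  refine ⟨C, hC, ?_⟩
  filter_upwards [eventually_ge_atTop x₀] with x hx y hy
  rw [div_le_iff₀ (hf.pos hanti hnn x), scaledTail]
  split_ifs with h0
  · exact h x hx y h0
  · have := hnn x
    have := Real.rpow_nonneg hy p
    positivity

theorem RegularlyVarying.tendsto_scaledTail {f : ℝ → ℝ} {α : ℝ} (hf : RegularlyVarying f (-α))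
    (hα : 0 < α) {y : ℝ} (hy : 0 ≤ y) :
    Tendsto (fun x => scaledTail f x y / f x) atTop (𝓝 (y ^ α)) := by
  rcases hy.eq_or_lt with rfl | hy
  · simp [scaledTail, Real.zero_rpow hα.ne']
  · simpa only [scaledTail, if_pos hy] using hf.tendsto_div hy

/-- If `g = o(f)` at infinity, the same holds after scaling. -/
theorem RegularlyVarying.tendsto_scaledTail_zero {f g : ℝ → ℝ} {ρ : ℝ}
    (hf : RegularlyVarying f (-ρ)) (hpos : ∀ x, 0 < f x)
    (hg : Tendsto (fun x => g x / f x) atTop (𝓝 0)) (y : ℝ) :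
    Tendsto (fun x => scaledTail g x y / f x) atTop (𝓝 0) := by
  unfold scaledTail
  split_ifs with hy
  · have h1 : Tendsto (fun x => g (x / y) / f (x / y)) atTop (𝓝 0) :=
      hg.comp (tendsto_id.atTop_div_const hy)
    have h2 := h1.mul (hf.tendsto_div hy)
    rw [zero_mul] at h2
    refine h2.congr fun x => ?_
    have := (hpos (x / y)).ne'
    field_simp
  · simp

/-- Breiman's lemma: for a weight `Z ≥ 0` with a moment of order `p > α`, independent of a variable
with regularly varying tail `f` of index `-α`, the product has tail asymptotic to `𝔼[Z ^ α] f`. -/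
theorem RegularlyVarying.tendsto_lintegral_scaledTail {f : ℝ → ℝ} {α p : ℝ}
    (hf : RegularlyVarying f (-α)) (hanti : Antitone f) (hnn : ∀ x, 0 ≤ f x) (hle : ∀ x, f x ≤ 1)
    (hα : 0 < α) (hp : α < p) {S : Type*} [MeasurableSpace S] {ν : Measure S} [IsFiniteMeasure ν]
    {Z : S → ℝ} (hZ : Measurable Z) (hZ0 : ∀ s, 0 ≤ Z s)
    (hZp : ∫⁻ s, ENNReal.ofReal (Z s ^ p) ∂ν ≠ ∞) :
    Tendsto (fun x => ∫⁻ s, ENNReal.ofReal (scaledTail f x (Z s) / f x) ∂ν) atTop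
      (𝓝 (∫⁻ s, ENNReal.ofReal (Z s ^ α) ∂ν)) := by
  obtain ⟨C, hC, hbound⟩ := hf.exists_scaledTail_le hanti hnn hle hp (hα.trans hp)
  refine tendsto_lintegral_filter_of_dominated_convergence
    (fun s => ENNReal.ofReal C * (1 + ENNReal.ofReal (Z s ^ p))) ?_ ?_ ?_ ?_
  · exact .of_forall fun x => (((hanti.measurable_scaledTail x).comp hZ).div_const _).ennreal_ofReal
  · filter_upwards [hbound] with x hx
    refine .of_forall fun s => ?_
    rw [← ENNReal.ofReal_one, ← ENNReal.ofReal_add zero_le_one (Real.rpow_nonneg (hZ0 s) _),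
      ← ENNReal.ofReal_mul hC.le]
    exact ENNReal.ofReal_le_ofReal (hx _ (hZ0 s))
  · rw [lintegral_const_mul' _ _ ENNReal.ofReal_ne_top, lintegral_add_left measurable_const,
      lintegral_const, one_mul]
    exact ENNReal.mul_ne_top ENNReal.ofReal_ne_top (ENNReal.add_ne_top.2 ⟨measure_ne_top _ _, hZp⟩)
  · exact .of_forall fun s => ENNReal.tendsto_ofReal (hf.tendsto_scaledTail hα (hZ0 s))

theorem ProbabilityTheory.IndepFun.measure_pair {Ω β γ : Type*} [MeasurableSpace Ω]
    [MeasurableSpace β] [MeasurableSpace γ] {μ : Measure Ω} [IsProbabilityMeasure μ] {Y : Ω → β}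
    {W : Ω → γ} (hYW : IndepFun Y W μ) (hY : Measurable Y) (hW : Measurable W)
    {A : Set (β × γ)} (hA : MeasurableSet A) :
    μ {ω | (Y ω, W ω) ∈ A} = ∫⁻ ω, μ {ω' | (Y ω', W ω) ∈ A} ∂μ := by
  have h := hYW.lintegral_pair hY.aemeasurable hW.aemeasurable (measurable_one.indicator hA)
  have h1 : MeasurableSet {ω | (Y ω, W ω) ∈ A} := (hY.prodMk hW) hA
  have h2 : ∀ ω, MeasurableSet {ω' | (Y ω', W ω) ∈ A} := fun ω => (hY.prodMk measurable_const) hA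
  rw [← lintegral_indicator_one h1]
  simp_rw [← lintegral_indicator_one (h2 _)]
  exact h

section Weights

variable {Ω : Type*} [MeasurableSpace Ω] {μ : Measure Ω} [IsProbabilityMeasure μ]
  {X : ℕ → Ω → ℝ} {N : Ω → ℕ} {Θ : ℕ → Ω → ℝ}

theorem tsum_measure_weighted_gt (hX : ∀ i, Measurable (X i))
    (hident : ∀ i, IdentDistrib (X i) (X 1) μ μ) (hN : Measurable N)
    (hΘ : ∀ i, Measurable (Θ i)) (hΘ0 : ∀ i ω, 0 ≤ Θ i ω)
    (hind : ∀ i j, IndepFun (fun ω => (X i ω, X j ω)) (fun ω => (N ω, Θ i ω, Θ j ω)) μ)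
    {x : ℝ} (hx : 0 < x) :
    ∑' i, μ {ω | i ∈ Finset.Icc 1 (N ω) ∧ x < X i ω * Θ i ω}
      = ∫⁻ ω, ∑ i ∈ Finset.Icc 1 (N ω), ENNReal.ofReal (scaledTail (tail μ (X 1)) x (Θ i ω)) ∂μ := by
  rw [lintegral_sum_Icc (f := fun i ω => ENNReal.ofReal (scaledTail (tail μ (X 1)) x (Θ i ω))) hN
    fun i => (((tail_antitone _).measurable_scaledTail x).comp (hΘ i)).ennreal_ofReal]
  refine tsum_congr fun i => ?_
  have hs : MeasurableSet {n : ℕ | i ∈ Finset.Icc 1 n} := .of_discrete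
  have hA : MeasurableSet {q : (ℝ × ℝ) × ℕ × ℝ × ℝ |
      i ∈ Finset.Icc 1 q.2.1 ∧ x < q.1.1 * q.2.2.1} :=
    (hs.preimage (show Measurable fun q : (ℝ × ℝ) × ℕ × ℝ × ℝ => q.2.1 by fun_prop)).inter
      (measurableSet_lt measurable_const
        (show Measurable fun q : (ℝ × ℝ) × ℕ × ℝ × ℝ => q.1.1 * q.2.2.1 by fun_prop))
  have h := (hind i i).measure_pair ((hX i).prodMk (hX i)) (hN.prodMk ((hΘ i).prodMk (hΘ i))) hA
  have hs' : MeasurableSet {ω | i ∈ Finset.Icc 1 (N ω)} := hN hs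
  rw [← lintegral_indicator hs']
  refine h.trans (lintegral_congr fun ω => ?_)
  simp only [Set.mem_ofPred_eq, Set.indicator_apply]
  by_cases hi : i ∈ Finset.Icc 1 (N ω)
  · simp only [hi, true_and, if_true]
    unfold scaledTail
    split_ifs with h0
    · rw [← (hident i).tail_eq, ofReal_tail]
      simp_rw [div_lt_iff₀ h0]
    · have : Θ i ω = 0 := le_antisymm (not_lt.1 h0) (hΘ0 i ω)
      simp [this, hx.not_gt]
  · simp [hi]

theorem measurable_sum_Icc (hN : Measurable N) {f : ℕ → Ω → ℝ≥0∞} (hf : ∀ i, Measurable (f i)) :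
    Measurable fun ω => ∑ i ∈ Finset.Icc 1 (N ω), f i ω := by
  have h : Measurable fun q : Ω × ℕ => ∑ i ∈ Finset.Icc 1 q.2, f i q.1 :=
    measurable_from_prod_countable_left fun n =>
      Finset.measurable_sum (Finset.Icc 1 n) fun i _ => hf i
  exact h.comp (measurable_id.prodMk hN)

/-- The event that two distinct terms `X i Θ i` and `X j Θ j` with `i, j ≤ N` both exceed the
fraction `δ / N` of the level `x`. -/
def twoLargeTerms (X : ℕ → Ω → ℝ) (N : Ω → ℕ) (Θ : ℕ → Ω → ℝ) (δ x : ℝ) (i j : ℕ) : Set Ω :=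
  {ω | (i ≠ j ∧ i ∈ Finset.Icc 1 (N ω) ∧ j ∈ Finset.Icc 1 (N ω)) ∧
    δ * x < N ω * (X i ω * Θ i ω) ∧ δ * x < N ω * (X j ω * Θ j ω)}

theorem tsum_measure_twoLargeTerms_le (hX : ∀ i, Measurable (X i)) (hX0 : ∀ i ω, 0 ≤ X i ω)
    (hN : Measurable N) (hΘ : ∀ i, Measurable (Θ i))
    (hind : ∀ i j, IndepFun (fun ω => (X i ω, X j ω)) (fun ω => (N ω, Θ i ω, Θ j ω)) μ)
    {δ x : ℝ} (hδ : 0 < δ) (hx : 0 < x) :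
    ∑' i, ∑' j, μ (twoLargeTerms X N Θ δ x i j)
      ≤ ∫⁻ ω, ∑ i ∈ Finset.Icc 1 (N ω), ∑ j ∈ Finset.Icc 1 (N ω), if i ≠ j then ENNReal.ofReal
          (scaledTail (jointTail μ (X i) (X j)) x (N ω / δ * max (Θ i ω) (Θ j ω))) else 0 ∂μ := by
  have hNr : Measurable fun ω => (N ω : ℝ) := measurable_from_nat.comp hN
  have hM : ∀ i j, Measurable fun ω => N ω / δ * max (Θ i ω) (Θ j ω) := fun i j =>
    (hNr.div_const _).mul ((hΘ i).max (hΘ j))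
  have hf : ∀ i j, Measurable fun ω => if i ≠ j then ENNReal.ofReal
      (scaledTail (jointTail μ (X i) (X j)) x (N ω / δ * max (Θ i ω) (Θ j ω))) else 0 := by
    intro i j
    split_ifs
    · exact (((jointTail_antitone _ _).measurable_scaledTail x).comp (hM i j)).ennreal_ofReal
    · exact measurable_const
  rw [lintegral_sum_Icc (f := fun i ω => ∑ j ∈ Finset.Icc 1 (N ω), if i ≠ j then ENNReal.ofReal
      (scaledTail (jointTail μ (X i) (X j)) x (N ω / δ * max (Θ i ω) (Θ j ω))) else 0) hN
    fun i => measurable_sum_Icc hN (hf i)]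
  refine ENNReal.tsum_le_tsum fun i => ?_
  rw [lintegral_sum_Icc hN (hf i)]
  refine ENNReal.tsum_le_tsum fun j => ?_
  have hs : ∀ i, MeasurableSet {ω | i ∈ Finset.Icc 1 (N ω)} := fun i =>
    hN (MeasurableSet.of_discrete (s := {n | i ∈ Finset.Icc 1 n}))
  rw [Measure.restrict_restrict (hs j), ← lintegral_indicator ((hs j).inter (hs i))]
  have hc : Measurable fun q : (ℝ × ℝ) × ℕ × ℝ × ℝ => (q.2.1 : ℝ) :=
    measurable_from_nat.comp (by fun_prop)
  have hset : MeasurableSet {n : ℕ | i ≠ j ∧ i ∈ Finset.Icc 1 n ∧ j ∈ Finset.Icc 1 n} := .of_discrete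
  have hA : MeasurableSet {q : (ℝ × ℝ) × ℕ × ℝ × ℝ |
      (i ≠ j ∧ i ∈ Finset.Icc 1 q.2.1 ∧ j ∈ Finset.Icc 1 q.2.1) ∧
      δ * x < q.2.1 * (q.1.1 * q.2.2.1) ∧ δ * x < q.2.1 * (q.1.2 * q.2.2.2)} :=
    (hset.preimage (show Measurable fun q : (ℝ × ℝ) × ℕ × ℝ × ℝ => q.2.1 by fun_prop)).inter
      ((measurableSet_lt measurable_const (hc.mul (by fun_prop))).inter
        (measurableSet_lt measurable_const (hc.mul (by fun_prop))))
  have h := (hind i j).measure_pair ((hX i).prodMk (hX j)) (hN.prodMk ((hΘ i).prodMk (hΘ j))) hA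
  refine h.trans_le (lintegral_mono fun ω => ?_)
  simp only [Set.mem_ofPred_eq, Set.indicator_apply, Set.mem_inter_iff]
  by_cases hij : i ≠ j ∧ i ∈ Finset.Icc 1 (N ω) ∧ j ∈ Finset.Icc 1 (N ω)
  · rw [if_pos ⟨hij.2.2, hij.2.1⟩, if_pos hij.1]
    set M : ℝ := N ω / δ * max (Θ i ω) (Θ j ω) with hMdef
    have hle : ∀ k, Θ k ω ≤ max (Θ i ω) (Θ j ω) → ∀ ω', δ * x < N ω * (X k ω' * Θ k ω) →
        x < X k ω' * M := by
      intro k hk ω' hlt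
      have h1 : (N ω : ℝ) * (X k ω' * Θ k ω) ≤ N ω * (X k ω' * max (Θ i ω) (Θ j ω)) := by
        have := hX0 k ω'
        gcongr
      have h2 : X k ω' * M = N ω * (X k ω' * max (Θ i ω) (Θ j ω)) / δ := by
        rw [hMdef]; ring
      rw [h2, lt_div_iff₀ hδ, mul_comm x]
      exact hlt.trans_le h1
    unfold scaledTail
    split_ifs with h0
    · rw [jointTail, ofReal_measureReal]
      refine measure_mono fun ω' hω' => ?_
      exact ⟨(div_lt_iff₀ h0).2 (hle i (le_max_left _ _) ω' hω'.2.1),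
        (div_lt_iff₀ h0).2 (hle j (le_max_right _ _) ω' hω'.2.2)⟩
    · rw [ENNReal.ofReal_zero, nonpos_iff_eq_zero]
      refine measure_mono_null (fun ω' hω' => ?_) measure_empty
      have h1 := hle i (le_max_left _ _) ω' hω'.2.1
      have h2 : X i ω' * M ≤ 0 := mul_nonpos_of_nonneg_of_nonpos (hX0 i ω') (not_lt.1 h0)
      exact (h1.trans_le h2).not_gt hx
  · simp only [hij, false_and, Set.ofPred_false, measure_empty, zero_le]

end Weights

/-! ### Two large terms are negligible -/

theorem exists_natCast_mul_rpow_le_two_pow {δ : ℝ} (hδ : 0 < δ) (p : ℝ) :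
    ∃ K : ℝ, 0 ≤ K ∧ ∀ n : ℕ, (n : ℝ) + 2 * n * (n / δ) ^ p ≤ K * 2 ^ n := by
  obtain ⟨m, hm⟩ := exists_nat_ge p
  obtain ⟨B, hB⟩ := (tendsto_pow_const_div_const_pow_of_one_lt (m + 1) (r := (2 : ℝ))
    one_lt_two).bddAbove_range
  have hB' : ∀ n : ℕ, (n : ℝ) ^ (m + 1) ≤ B * 2 ^ n := fun n =>
    (div_le_iff₀ (by positivity)).1 (hB ⟨n, rfl⟩)
  have hB0 : 0 ≤ B := by simpa using hB' 0
  have hδp : 0 < δ ^ p := Real.rpow_pos_of_pos hδ p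
  refine ⟨B * (1 + 2 / δ ^ p), by positivity, fun n => ?_⟩
  rcases Nat.eq_zero_or_pos n with rfl | hn
  · simp only [Nat.cast_zero, mul_zero, zero_mul, add_zero]
    positivity
  have hn1 : (1 : ℝ) ≤ n := by exact_mod_cast hn
  have h1 : (n : ℝ) ≤ n ^ (m + 1) := le_self_pow₀ hn1 (by omega)
  have h2 : (n : ℝ) ^ p ≤ n ^ m := by
    rw [← Real.rpow_natCast]
    exact Real.rpow_le_rpow_of_exponent_le hn1 hm
  calc (n : ℝ) + 2 * n * (n / δ) ^ p = n + 2 / δ ^ p * (n * n ^ p) := by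
        rw [Real.div_rpow (by positivity) hδ.le]; ring
    _ ≤ n ^ (m + 1) + 2 / δ ^ p * (n * n ^ m) := by gcongr
    _ = (1 + 2 / δ ^ p) * n ^ (m + 1) := by ring
    _ ≤ (1 + 2 / δ ^ p) * (B * 2 ^ n) := by gcongr; exact hB' n
    _ = B * (1 + 2 / δ ^ p) * 2 ^ n := by ring

section Weights

variable {Ω : Type*} [MeasurableSpace Ω] {μ : Measure Ω} [IsProbabilityMeasure μ]
  {X : ℕ → Ω → ℝ} {N : Ω → ℕ} {Θ : ℕ → Ω → ℝ}

/-- By tail independence the probability that two of the `N` terms are comparable with the level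
`x` is `o(ℙ(X 1 > x))`. Given the weights each pair contributes `o(ℙ(X 1 > x))`, and Potter's
bound dominates the sum over the pairs by a multiple of `2 ^ N ∑ (1 + Θ i ^ p)`. -/
theorem tendsto_tsum_measure_twoLargeTerms (hX : ∀ i, Measurable (X i)) (hX0 : ∀ i ω, 0 ≤ X i ω)
    (hident : ∀ i, IdentDistrib (X i) (X 1) μ μ) {α p : ℝ}
    (hrv : RegularlyVarying (tail μ (X 1)) (-α)) (hti : UniformTailIndependent μ X)
    (hα : 0 < α) (hp : α < p) (hN : Measurable N) (hΘ : ∀ i, Measurable (Θ i))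
    (hΘ0 : ∀ i ω, 0 ≤ Θ i ω)
    (hind : ∀ i j, IndepFun (fun ω => (X i ω, X j ω)) (fun ω => (N ω, Θ i ω, Θ j ω)) μ)
    (hmom : ∫⁻ ω, ∑ i ∈ Finset.Icc 1 (N ω), 2 ^ N ω * ENNReal.ofReal (1 + Θ i ω ^ p) ∂μ ≠ ∞)
    {δ : ℝ} (hδ : 0 < δ) :
    Tendsto (fun x => (∑' i, ∑' j, μ (twoLargeTerms X N Θ δ x i j))
      / ENNReal.ofReal (tail μ (X 1) x)) atTop (𝓝 0) := by
  have hp0 : 0 < p := hα.trans hp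
  set F := tail μ (X 1) with hF
  have hanti : Antitone F := tail_antitone _
  have hpos : ∀ x, 0 < F x := hrv.pos hanti (tail_nonneg _)
  obtain ⟨C, hC, hbound⟩ :=
    hrv.exists_scaledTail_le hanti (tail_nonneg _) (tail_le_one _) hp hp0
  obtain ⟨K, hK, hKn⟩ := exists_natCast_mul_rpow_le_two_pow hδ p
  set M : ℕ → ℕ → Ω → ℝ := fun i j ω => N ω / δ * max (Θ i ω) (Θ j ω) with hM
  have hM0 : ∀ i j ω, 0 ≤ M i j ω := fun i j ω =>
    mul_nonneg (by positivity) ((hΘ0 i ω).trans (le_max_left _ _))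
  have hMmeas : ∀ i j, Measurable (M i j) := fun i j =>
    ((measurable_from_nat.comp hN).div_const _).mul ((hΘ i).max (hΘ j))
  let J : ℕ → ℕ → ℝ → ℝ := fun i j => jointTail μ (X i) (X j)
  have hJF : ∀ i j x, J i j x ≤ F x := fun i j x =>
    (jointTail_le_tail _ _ x).trans_eq ((hident i).tail_eq x)
  let q : ℝ → ℕ → ℕ → Ω → ℝ≥0∞ := fun x i j ω =>
    if i ≠ j then ENNReal.ofReal (scaledTail (J i j) x (M i j ω) / F x) else 0
  have hq : ∀ x i j, Measurable (q x i j) := by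
    intro x i j
    by_cases hij : i ≠ j
    · simp only [q, if_pos hij]
      exact ((((jointTail_antitone _ _).measurable_scaledTail x).comp
        (hMmeas i j)).div_const _).ennreal_ofReal
    · simp only [q, if_neg hij]
      exact measurable_const
  have hlim : Tendsto (fun x => ∫⁻ ω, ∑ i ∈ Finset.Icc 1 (N ω), ∑ j ∈ Finset.Icc 1 (N ω),
      q x i j ω ∂μ) atTop (𝓝 (∫⁻ _, 0 ∂μ)) := by
    refine tendsto_lintegral_filter_of_dominated_convergence
      (fun ω => ENNReal.ofReal (C * K) *
        ∑ i ∈ Finset.Icc 1 (N ω), 2 ^ N ω * ENNReal.ofReal (1 + Θ i ω ^ p)) ?_ ?_ ?_ ?_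
    · exact .of_forall fun x => measurable_sum_Icc hN fun i => measurable_sum_Icc hN (hq x i)
    · filter_upwards [hbound] with x hx
      refine .of_forall fun ω => ?_
      have hΘp : ∀ i, 0 ≤ Θ i ω ^ p := fun i => Real.rpow_nonneg (hΘ0 i ω) p
      set n := N ω with hn
      set b : ℝ := (n / δ) ^ p with hb
      have hb0 : 0 ≤ b := Real.rpow_nonneg (by positivity) p
      have hqle : ∀ i j, q x i j ω ≤ ENNReal.ofReal (C * (1 + b * (Θ i ω ^ p + Θ j ω ^ p))) := by
        intro i j
        simp only [q]
        split_ifs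
        · refine ENNReal.ofReal_le_ofReal ?_
          calc scaledTail (J i j) x (M i j ω) / F x ≤ scaledTail F x (M i j ω) / F x := by
                have := hpos x
                gcongr
                exact scaledTail_mono (hJF i j) _ _
            _ ≤ C * (1 + M i j ω ^ p) := hx _ (hM0 i j ω)
            _ ≤ C * (1 + b * (Θ i ω ^ p + Θ j ω ^ p)) := by
                gcongr
                simp only [hM]
                rw [Real.mul_rpow (by positivity) ((hΘ0 i ω).trans (le_max_left _ _))]
                gcongr
                rcases max_choice (Θ i ω) (Θ j ω) with h | h <;> rw [h]
                · linarith [hΘp j]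
                · linarith [hΘp i]
        · exact zero_le
      have hterm : ∀ i j, 0 ≤ C * (1 + b * (Θ i ω ^ p + Θ j ω ^ p)) := fun i j => by
        have := hΘp i
        have := hΘp j
        positivity
      calc ∑ i ∈ Finset.Icc 1 n, ∑ j ∈ Finset.Icc 1 n, q x i j ω
          ≤ ∑ i ∈ Finset.Icc 1 n, ∑ j ∈ Finset.Icc 1 n,
              ENNReal.ofReal (C * (1 + b * (Θ i ω ^ p + Θ j ω ^ p))) :=
            Finset.sum_le_sum fun i _ => Finset.sum_le_sum fun j _ => hqle i j
        _ = ENNReal.ofReal (∑ i ∈ Finset.Icc 1 n, ∑ j ∈ Finset.Icc 1 n,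
              C * (1 + b * (Θ i ω ^ p + Θ j ω ^ p))) := by
            rw [ENNReal.ofReal_sum_of_nonneg fun i _ => Finset.sum_nonneg fun j _ => hterm i j]
            refine Finset.sum_congr rfl fun i _ => ?_
            rw [ENNReal.ofReal_sum_of_nonneg fun j _ => hterm i j]
        _ ≤ ENNReal.ofReal (C * K * ∑ i ∈ Finset.Icc 1 n, 2 ^ n * (1 + Θ i ω ^ p)) := by
            refine ENNReal.ofReal_le_ofReal ?_
            have hsum : 0 ≤ ∑ i ∈ Finset.Icc 1 n, Θ i ω ^ p := Finset.sum_nonneg fun i _ => hΘp i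
            have h1 : ∑ i ∈ Finset.Icc 1 n, ∑ j ∈ Finset.Icc 1 n,
                C * (1 + b * (Θ i ω ^ p + Θ j ω ^ p))
                = C * (n * n + 2 * n * b * ∑ i ∈ Finset.Icc 1 n, Θ i ω ^ p) := by
              simp only [← Finset.mul_sum, Finset.sum_add_distrib, Finset.sum_const, Nat.card_Icc,
                nsmul_eq_mul, Nat.add_sub_cancel]
              ring
            have h2 : ∑ i ∈ Finset.Icc 1 n, 2 ^ n * (1 + Θ i ω ^ p)
                = 2 ^ n * (n + ∑ i ∈ Finset.Icc 1 n, Θ i ω ^ p) := by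
              simp only [← Finset.mul_sum, Finset.sum_add_distrib, Finset.sum_const, Nat.card_Icc,
                nsmul_eq_mul, Nat.add_sub_cancel, mul_one]
            rw [h1, h2, mul_assoc C K]
            refine mul_le_mul_of_nonneg_left ?_ hC.le
            calc (n : ℝ) * n + 2 * n * b * ∑ i ∈ Finset.Icc 1 n, Θ i ω ^ p
                ≤ (n + 2 * n * b) * (n + ∑ i ∈ Finset.Icc 1 n, Θ i ω ^ p) := by
                  have h3 : 0 ≤ 2 * (n : ℝ) * b * n + n * ∑ i ∈ Finset.Icc 1 n, Θ i ω ^ p := by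
                    positivity
                  linarith
              _ ≤ (K * 2 ^ n) * (n + ∑ i ∈ Finset.Icc 1 n, Θ i ω ^ p) := by
                  gcongr
                  exact hKn n
              _ = _ := by ring
        _ = _ := by
            rw [ENNReal.ofReal_mul (by positivity), ENNReal.ofReal_sum_of_nonneg fun i _ => by
              have := hΘp i
              positivity]
            congr 1
            refine Finset.sum_congr rfl fun i _ => ?_
            rw [ENNReal.ofReal_mul (by positivity), ENNReal.ofReal_pow zero_le_two,
              ENNReal.ofReal_ofNat]
    · rw [lintegral_const_mul' _ _ ENNReal.ofReal_ne_top]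
      exact ENNReal.mul_ne_top ENNReal.ofReal_ne_top hmom
    · refine .of_forall fun ω => ?_
      have h0 : (0 : ℝ≥0∞) = ∑ i ∈ Finset.Icc 1 (N ω), ∑ j ∈ Finset.Icc 1 (N ω), 0 := by simp
      rw [h0]
      refine tendsto_finsetSum _ fun i hi => tendsto_finsetSum _ fun j hj => ?_
      simp only [q]
      split_ifs with hij
      · rw [← ENNReal.ofReal_zero]
        exact ENNReal.tendsto_ofReal (hrv.tendsto_scaledTail_zero hpos
          (hti.tendsto_jointTail hident (Finset.mem_Icc.1 hi).1 (Finset.mem_Icc.1 hj).1 hij) _)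
      · exact tendsto_const_nhds
  rw [lintegral_zero] at hlim
  refine tendsto_of_tendsto_of_tendsto_of_le_of_le' tendsto_const_nhds hlim
    (.of_forall fun _ => zero_le) ?_
  filter_upwards [eventually_gt_atTop 0] with x hx
  have hFx : ENNReal.ofReal (F x) ≠ 0 := (ENNReal.ofReal_pos.2 (hpos x)).ne'
  refine ENNReal.div_le_of_le_mul ?_
  rw [← lintegral_mul_const' _ _ ENNReal.ofReal_ne_top]
  refine (tsum_measure_twoLargeTerms_le hX hX0 hN hΘ hind hδ hx).trans_eq
    (lintegral_congr fun ω => ?_)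
  simp only [Finset.sum_mul, q]
  refine Finset.sum_congr rfl fun i _ => Finset.sum_congr rfl fun j _ => ?_
  split_ifs
  · rw [ENNReal.ofReal_div_of_pos (hpos x), ENNReal.div_mul_cancel hFx ENNReal.ofReal_ne_top]
  · rw [zero_mul]

end Weights

/-! ### The principle of a single large term -/

/-- A Bonferroni inequality: the union bound fails to be sharp by at most the sum, over the pairs of
events, of the probabilities that both occur. -/
theorem tsum_measure_le_measure_iUnion_add {Ω : Type*} [MeasurableSpace Ω] {μ : Measure Ω}
    {A : ℕ → Set Ω} (hA : ∀ i, MeasurableSet (A i)) {D : ℕ → ℕ → Set Ω}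
    (hD : ∀ i j, i ≠ j → A i ∩ A j ⊆ D i j) :
    ∑' i, μ (A i) ≤ μ (⋃ i, A i) + ∑' i, ∑' j, μ (D i j) := by
  rw [← iUnion_disjointed, measure_iUnion (disjoint_disjointed A)
    (fun i => MeasurableSet.disjointed hA i), ← ENNReal.tsum_add]
  refine ENNReal.tsum_le_tsum fun i => ?_
  have hsub : A i ⊆ disjointed A i ∪ ⋃ j, D i j := by
    intro ω hω
    by_cases h : ω ∈ disjointed A i
    · exact Or.inl h
    · rw [disjointed_eq_inter_compl] at h
      simp only [Set.mem_inter_iff, hω, true_and, Set.mem_iInter, Set.mem_compl_iff, not_forall,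
        not_not] at h
      obtain ⟨j, hj, hjω⟩ := h
      exact Or.inr (Set.mem_iUnion.2 ⟨j, hD i j (ne_of_gt hj) ⟨hω, hjω⟩⟩)
  exact (measure_mono hsub).trans ((measure_union_le _ _).trans
    (add_le_add_right (measure_iUnion_le _) _))

/-- If a sum of `n` terms exceeds `x` while no term exceeds `(1 - δ) x`, then two
terms exceed `δ x / n`: the largest one, and one of the others, which add up to more than `δ x`. -/
theorem exists_two_large_of_lt_sum {n : ℕ} {v : ℕ → ℝ} {δ x : ℝ} (hδ : 0 < δ)
    (hδ1 : δ < 1) (hx : 0 < x) (hsum : x < ∑ i ∈ Finset.Icc 1 n, v i)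
    (hle : ∀ i ∈ Finset.Icc 1 n, v i ≤ (1 - δ) * x) :
    ∃ i ∈ Finset.Icc 1 n, ∃ j ∈ Finset.Icc 1 n, i ≠ j ∧ δ * x < n * v i ∧ δ * x < n * v j := by
  have hne : (Finset.Icc 1 n).Nonempty := by
    by_contra h
    rw [Finset.not_nonempty_iff_eq_empty.1 h, Finset.sum_empty] at hsum
    exact hsum.not_gt hx
  have hn : (0 : ℝ) < n := by
    have := Finset.nonempty_Icc.1 hne
    exact_mod_cast this
  obtain ⟨i, hi, hmax⟩ := Finset.exists_max_image _ v hne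
  have hcard : ∑ j ∈ Finset.Icc 1 n, v i = n * v i := by simp
  have hi2 : x < n * v i := hcard ▸ hsum.trans_le (Finset.sum_le_sum hmax)
  refine ⟨i, hi, ?_⟩
  by_contra hcon
  push Not at hcon
  have hδx : δ * x < x := mul_lt_of_lt_one_left hx hδ1
  have hrest : ∑ j ∈ (Finset.Icc 1 n).erase i, v j ≤ δ * x := by
    calc ∑ j ∈ (Finset.Icc 1 n).erase i, v j ≤ ∑ j ∈ (Finset.Icc 1 n).erase i, δ * x / n := by
          refine Finset.sum_le_sum fun j hj => ?_
          rw [le_div_iff₀ hn, mul_comm]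
          exact hcon j (Finset.mem_of_mem_erase hj) (Finset.ne_of_mem_erase hj).symm
            (hδx.trans hi2)
      _ ≤ ∑ j ∈ Finset.Icc 1 n, δ * x / n :=
          Finset.sum_le_sum_of_subset_of_nonneg (Finset.erase_subset _ _)
            fun _ _ _ => by positivity
      _ = δ * x := by
          rw [Finset.sum_const, Nat.card_Icc, Nat.add_sub_cancel, nsmul_eq_mul]
          field_simp
  have := hle i hi
  rw [← Finset.add_sum_erase _ _ hi] at hsum
  linarith

/-- The sandwich behind the principle of a single large term: if `Ψ x` is at least
`a x - R 1 x` and at most `a ((1 - δ) x) + R δ x`, where `a ∼ L f` and `R δ = o(f)`, then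
`Ψ ∼ L f`. -/
theorem RegularlyVarying.tendsto_div_of_sandwich {f : ℝ → ℝ} {ρ : ℝ} (hf : RegularlyVarying f ρ)
    (hpos : ∀ x, 0 < f x) {a Ψ : ℝ → ℝ≥0∞} {R : ℝ → ℝ → ℝ≥0∞} {L : ℝ≥0∞} (hL : L ≠ ∞)
    (ha : Tendsto (fun x => a x / ENNReal.ofReal (f x)) atTop (𝓝 L))
    (hR : ∀ δ, 0 < δ → Tendsto (fun x => R δ x / ENNReal.ofReal (f x)) atTop (𝓝 0))
    (hlow : ∀ x, 0 < x → a x ≤ Ψ x + R 1 x)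
    (hup : ∀ δ, 0 < δ → δ < 1 → ∀ x, 0 < x → Ψ x ≤ a ((1 - δ) * x) + R δ x) :
    Tendsto (fun x => Ψ x / ENNReal.ofReal (f x)) atTop (𝓝 L) := by
  refine tendsto_order.2 ⟨fun b hb => ?_, fun b hb => ?_⟩
  · have h := ENNReal.Tendsto.sub ha (hR 1 one_pos) (Or.inl hL)
    rw [tsub_zero] at h
    filter_upwards [h.eventually (lt_mem_nhds hb), eventually_gt_atTop 0] with x hx hx0
    refine hx.trans_le (tsub_le_iff_right.2 ?_)
    rw [← ENNReal.add_div]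
    exact ENNReal.div_le_div_right (hlow x hx0) _
  · have h1 : Tendsto (fun δ : ℝ => L * ENNReal.ofReal ((1 - δ) ^ ρ)) (𝓝[>] 0) (𝓝 L) := by
      have hc : ContinuousAt (fun δ : ℝ => (1 - δ) ^ ρ) 0 :=
        ContinuousAt.rpow_const (by fun_prop) (Or.inl (by norm_num))
      have h2 := ENNReal.Tendsto.const_mul (a := L) (ENNReal.tendsto_ofReal hc.tendsto)
        (Or.inr hL)
      simp only [sub_zero, Real.one_rpow, ENNReal.ofReal_one, mul_one] at h2
      exact h2.mono_left nhdsWithin_le_nhds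
    obtain ⟨δ, hδb, hδ0, hδ1⟩ := ((h1.eventually (gt_mem_nhds hb)).and
      (Ioo_mem_nhdsGT (zero_lt_one' ℝ))).exists
    have hδ : 0 < 1 - δ := by linarith
    have h3 : Tendsto (fun x => a ((1 - δ) * x) / ENNReal.ofReal (f ((1 - δ) * x))
        * ENNReal.ofReal (f ((1 - δ) * x) / f x) + R δ x / ENNReal.ofReal (f x)) atTop
        (𝓝 (L * ENNReal.ofReal ((1 - δ) ^ ρ) + 0)) :=
      (ENNReal.Tendsto.mul (ha.comp (tendsto_id.const_mul_atTop hδ))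
        (Or.inr ENNReal.ofReal_ne_top) (ENNReal.tendsto_ofReal (hf _ hδ)) (Or.inr hL)).add (hR δ hδ0)
    rw [add_zero] at h3
    filter_upwards [h3.eventually (gt_mem_nhds hδb), eventually_gt_atTop 0] with x hx hx0
    refine lt_of_le_of_lt ?_ hx
    have h4 : a ((1 - δ) * x) / ENNReal.ofReal (f ((1 - δ) * x))
        * ENNReal.ofReal (f ((1 - δ) * x) / f x) = a ((1 - δ) * x) / ENNReal.ofReal (f x) := by
      rw [ENNReal.ofReal_div_of_pos (hpos x), ← mul_div_assoc,
        ENNReal.div_mul_cancel (ENNReal.ofReal_pos.2 (hpos _)).ne' ENNReal.ofReal_ne_top]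
    rw [h4, ← ENNReal.add_div]
    exact ENNReal.div_le_div_right (hup δ hδ0 hδ1 x hx0) _

/-! ### The ruin event -/

section Ruin

variable {Ω E : Type*} {X : ℕ → Ω → ℝ} {τ : ℕ → Ω → ℝ≥0∞} {h : E → ℝ → ℝ → ℝ}
  {ξ : ℕ → Ω → E}

/-- At the `i`-th arrival the shot noise is at least its `i`-th term, so one large term causes
ruin. -/
theorem IsArrivalSequence.lt_iSup_shotNoise [MeasurableSpace Ω] (hτ : IsArrivalSequence τ)
    (hX0 : ∀ i ω, 0 ≤ X i ω) (hh0 : ∀ e t s, 0 ≤ h e t s) {T : ℝ≥0} {ω : Ω} {i : ℕ} {x : ℝ}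
    (hi : i ∈ Finset.Icc 1 (arrivalCount τ T ω))
    (hx : x < X i ω * h (ξ i ω) (τ i ω).toReal (τ i ω).toReal) :
    (x : EReal) < ⨆ t ∈ Set.Icc (0 : ℝ≥0) T,
      (shotNoise X (fun i ω => h (ξ i ω)) τ t ω : EReal) := by
  obtain ⟨hi1, hiT⟩ := hτ.le_iff.1 hi
  have hne : τ i ω ≠ ∞ := (hiT.trans_lt ENNReal.coe_lt_top).ne
  have ht : (τ i ω).toNNReal ∈ Set.Icc (0 : ℝ≥0) T :=
    ⟨zero_le, by simpa using ENNReal.toNNReal_mono ENNReal.coe_ne_top hiT⟩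
  have hi' : i ∈ Finset.Icc 1 (arrivalCount τ (τ i ω).toNNReal ω) :=
    hτ.le_iff.2 ⟨hi1, (ENNReal.coe_toNNReal hne).ge⟩
  have hle : X i ω * h (ξ i ω) (τ i ω).toReal (τ i ω).toReal
      ≤ shotNoise X (fun i ω => h (ξ i ω)) τ (τ i ω).toNNReal ω :=
    Finset.single_le_sum (f := fun k => X k ω * h (ξ k ω) (τ i ω).toReal (τ k ω).toReal)
      (fun k _ => mul_nonneg (hX0 k ω) (hh0 _ _ _)) hi'
  exact (EReal.coe_lt_coe_iff.2 (hx.trans_le hle)).trans_le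
    (le_iSup₂ (f := fun (t : ℝ≥0) (_ : t ∈ Set.Icc (0 : ℝ≥0) T) =>
      (shotNoise X (fun i ω => h (ξ i ω)) τ t ω : EReal)) _ ht)

/-- As the shock functions are non-increasing, the shot noise never exceeds the sum of the initial
values of all shocks up to the horizon. -/
theorem IsArrivalSequence.iSup_shotNoise_le [MeasurableSpace Ω] (hτ : IsArrivalSequence τ)
    (hX0 : ∀ i ω, 0 ≤ X i ω) (hh0 : ∀ e t s, 0 ≤ h e t s)
    (hanti : ∀ e s, 0 < s → AntitoneOn (fun t => h e t s) (Set.Ici s)) (T : ℝ≥0) {ω : Ω}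
    (h0 : arrivalCount τ 0 ω = 0) :
    ⨆ t ∈ Set.Icc (0 : ℝ≥0) T, (shotNoise X (fun i ω => h (ξ i ω)) τ t ω : EReal)
      ≤ ((∑ i ∈ Finset.Icc 1 (arrivalCount τ T ω),
          X i ω * h (ξ i ω) (τ i ω).toReal (τ i ω).toReal : ℝ) : EReal) := by
  refine iSup₂_le fun t ht => EReal.coe_le_coe_iff.2 ?_
  calc shotNoise X (fun i ω => h (ξ i ω)) τ t ω
      ≤ ∑ i ∈ Finset.Icc 1 (arrivalCount τ t ω),
          X i ω * h (ξ i ω) (τ i ω).toReal (τ i ω).toReal := by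
        refine Finset.sum_le_sum fun i hi => mul_le_mul_of_nonneg_left ?_ (hX0 i ω)
        obtain ⟨hi1, hit⟩ := hτ.le_iff.1 hi
        have hne : τ i ω ≠ ∞ := (hit.trans_lt ENNReal.coe_lt_top).ne
        have hpos : τ i ω ≠ 0 := by
          intro hzero
          have := hτ.le_iff (t := 0) (ω := ω) (i := i) |>.2 ⟨hi1, by simp [hzero]⟩
          simp only [h0, Finset.mem_Icc] at this
          omega
        have hle : (τ i ω).toReal ≤ t := by
          simpa using ENNReal.toReal_mono ENNReal.coe_ne_top hit
        exact hanti (ξ i ω) _ (ENNReal.toReal_pos hpos hne) Set.self_mem_Ici hle hle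
    _ ≤ _ := Finset.sum_le_sum_of_subset_of_nonneg
        (Finset.Icc_subset_Icc_right (hτ.arrivalCount_mono ω ht.2))
        fun i _ _ => mul_nonneg (hX0 i ω) (hh0 _ _ _)

end Ruin

/-! ### Asymptotics of the ruin probability -/

/-- The shock functions are `H i (t, s) = h (ξ i) t s` with i.i.d. random elements `ξ i` of a
measurable space `E` and a jointly measurable `h`; this is what i.i.d. measurable random functions
are. The pair `(ζ, V₀)` is a generic one: `h ζ` is a copy `h₀` of the shock functions, and `V₀` is
independent of it with density `lam / m(T)` on `[0, T]`. -/
theorem corollary4p2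
    {Ω : Type*} [MeasurableSpace Ω] (μ : Measure Ω) [IsProbabilityMeasure μ]
    {E : Type*} [MeasurableSpace E]
    (α : ℝ) (hα : 0 < α)
    -- the shocks
    (X : ℕ → Ω → ℝ) (hX_meas : ∀ i, Measurable (X i)) (hX_nonneg : ∀ i ω, 0 ≤ X i ω)
    (hX_ident : ∀ i, IdentDistrib (X i) (X 1) μ μ)
    (hX_rv : RegularlyVarying (tail μ (X 1)) (-α))
    (hX_indep : UniformTailIndependent μ X)
    -- the shock instants
    (lam : ℝ → ℝ) (τ : ℕ → Ω → ℝ≥0∞) (hτ : IsArrivalSequence τ)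
    (hN : IsInhomogeneousPoisson μ (arrivalCount τ) lam)
    -- the shock functions
    (h : E → ℝ → ℝ → ℝ) (hh_meas : Measurable (fun p : E × ℝ × ℝ => h p.1 p.2.1 p.2.2))
    (hh_nonneg : ∀ e t s, 0 ≤ h e t s)
    (hh_anti : ∀ e s, 0 < s → AntitoneOn (fun t => h e t s) (Set.Ici s))
    (ξ : ℕ → Ω → E) (hξ_meas : ∀ i, Measurable (ξ i))
    (hξ_indep : iIndepFun ξ μ) (hξ_ident : ∀ i, IdentDistrib (ξ i) (ξ 1) μ μ)
    -- the shocks, the shock functions and the shock instants are independent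
    (h_indep_shape : IndepFun (fun ω i => ξ i ω) (fun ω i => τ i ω) μ)
    (h_indep_shock : IndepFun (fun ω i => X i ω)
      (fun ω => ((fun i => ξ i ω, fun i => τ i ω) : (ℕ → E) × (ℕ → ℝ≥0∞))) μ)
    -- the time horizon and the generic pair
    (T : ℝ≥0) (hT : 0 < T)
    {Ω' : Type*} [MeasurableSpace Ω'] (P : Measure Ω') [IsProbabilityMeasure P]
    (ζ : Ω' → E) (V₀ : Ω' → ℝ) (hζ : IdentDistrib ζ (ξ 1) P μ)
    (hV₀ : HasLaw V₀ (arrivalLaw lam T) P) (hζV₀ : IndepFun ζ V₀ P)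
    (h_moment : ∃ p : ℝ, α < p ∧ Integrable (fun ω => h (ζ ω) (V₀ ω) (V₀ ω) ^ p) P) :
    Tendsto
      (fun x : ℝ => ruinProb μ (shotNoise X (fun i ω => h (ξ i ω)) τ) x T / tail μ (X 1) x)
      atTop
      (𝓝 (cumIntensity lam T * ∫ ω, h (ζ ω) (V₀ ω) (V₀ ω) ^ α ∂P)) := by
  obtain ⟨p, hp, hint⟩ := h_moment
  set N : Ω → ℕ := arrivalCount τ T with hNdef
  set Θ : ℕ → Ω → ℝ := fun i ω => h (ξ i ω) (τ i ω).toReal (τ i ω).toReal with hΘdef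
  set Z : E × ℝ → ℝ := fun q => h q.1 q.2 q.2 with hZdef
  set F : ℝ → ℝ := tail μ (X 1) with hF
  have hanti : Antitone F := tail_antitone _
  have hpos : ∀ x, 0 < F x := hX_rv.pos hanti (tail_nonneg _)
  have hZ : Measurable Z :=
    hh_meas.comp (measurable_fst.prodMk (measurable_snd.prodMk measurable_snd))
  have hZ0 : ∀ q, 0 ≤ Z q := fun q => hh_nonneg _ _ _
  have hNmeas : Measurable N := hτ.measurable_arrivalCount T
  have hτi : ∀ i, Measurable fun ω => (τ i ω).toReal := fun i => (hτ.measurable i).ennreal_toReal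
  have hΘ : ∀ i, Measurable (Θ i) := fun i => hZ.comp ((hξ_meas i).prodMk (hτi i))
  have hΘ0 : ∀ i ω, 0 ≤ Θ i ω := fun i ω => hh_nonneg _ _ _
  have hζm : AEMeasurable ζ P := hζ.aemeasurable_fst
  have hpair : AEMeasurable (fun ω => (ζ ω, V₀ ω)) P := hζm.prodMk hV₀.aemeasurable
  -- the joint law of the generic mark and arrival time
  set ν : Measure (E × ℝ) := P.map fun ω => (ζ ω, V₀ ω) with hν
  have hνprob : IsProbabilityMeasure ν := Measure.isProbabilityMeasure_map hpair
  have hcampbell : ∀ (c : ℝ≥0) {g : E × ℝ → ℝ≥0∞}, Measurable g →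
      ∫⁻ ω, ∑ i ∈ Finset.Icc 1 (N ω), (c : ℝ≥0∞) ^ N ω * g (ξ i ω, (τ i ω).toReal) ∂μ
      = c * ENNReal.ofReal (Real.exp ((c - 1) * cumIntensity lam T))
        * (ENNReal.ofReal (cumIntensity lam T) * ∫⁻ q, g q ∂ν) := by
    intro c g hg
    rw [hν, lintegral_map' hg.aemeasurable hpair]
    exact lintegral_pow_mul_sum_marked hτ hN hξ_meas hξ_ident h_indep_shape hζ hV₀ hζV₀ hg c
  have hZp : ∫⁻ q, ENNReal.ofReal (Z q ^ p) ∂ν ≠ ∞ := by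
    rw [hν, lintegral_map' (hZ.pow_const p).ennreal_ofReal.aemeasurable hpair]
    exact hint.lintegral_lt_top.ne
  have hmom : ∫⁻ ω, ∑ i ∈ Finset.Icc 1 (N ω), 2 ^ N ω * ENNReal.ofReal (1 + Θ i ω ^ p) ∂μ ≠ ∞ := by
    have hg : Measurable fun q => ENNReal.ofReal (1 + Z q ^ p) :=
      ((hZ.pow_const p).const_add 1).ennreal_ofReal
    have h2 := hcampbell 2 hg
    rw [ENNReal.coe_ofNat] at h2
    refine (h2.trans_ne ?_)
    have hfin : ∫⁻ q, ENNReal.ofReal (1 + Z q ^ p) ∂ν ≠ ∞ := by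
      simp_rw [fun q => ENNReal.ofReal_add zero_le_one (Real.rpow_nonneg (hZ0 q) p)]
      rw [lintegral_add_left measurable_const, lintegral_const, measure_univ, mul_one]
      exact ENNReal.add_ne_top.2 ⟨ENNReal.ofReal_ne_top, hZp⟩
    exact ENNReal.mul_ne_top (ENNReal.mul_ne_top ENNReal.ofNat_ne_top ENNReal.ofReal_ne_top)
      (ENNReal.mul_ne_top ENNReal.ofReal_ne_top hfin)
  have hind : ∀ i j, IndepFun (fun ω => (X i ω, X j ω)) (fun ω => (N ω, Θ i ω, Θ j ω)) μ := by
    intro i j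
    obtain ⟨φ, hφ, hφe⟩ := hτ.exists_measurable_comp T
    have h1 : Measurable fun w : ℕ → ℝ => (w i, w j) :=
      (measurable_pi_apply i).prodMk (measurable_pi_apply j)
    have hmark : ∀ k, Measurable fun w : (ℕ → E) × (ℕ → ℝ≥0∞) => Z (w.1 k, (w.2 k).toReal) :=
      fun k => hZ.comp (((measurable_pi_apply k).comp measurable_fst).prodMk
        ((measurable_pi_apply k).comp measurable_snd).ennreal_toReal)
    have h2 : Measurable fun w : (ℕ → E) × (ℕ → ℝ≥0∞) =>
        (φ w.2, Z (w.1 i, (w.2 i).toReal), Z (w.1 j, (w.2 j).toReal)) :=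
      (hφ.comp measurable_snd).prodMk ((hmark i).prodMk (hmark j))
    have h3 := h_indep_shock.comp h1 h2
    simpa only [Function.comp_def, ← hφe] using h3
  -- by Campbell's formula and Breiman's lemma the expected number of terms above `x` is `∼ L F x`,
  -- where `L` is the limit claimed
  have ha : Tendsto (fun x => (∑' i, μ {ω | i ∈ Finset.Icc 1 (N ω) ∧ x < X i ω * Θ i ω})
      / ENNReal.ofReal (F x)) atTop
      (𝓝 (ENNReal.ofReal (cumIntensity lam T) * ∫⁻ q, ENNReal.ofReal (Z q ^ α) ∂ν)) := by
    refine (ENNReal.Tendsto.const_mul (hX_rv.tendsto_lintegral_scaledTail hanti (tail_nonneg _)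
      (tail_le_one _) hα hp hZ hZ0 hZp) (Or.inr ENNReal.ofReal_ne_top)).congr' ?_
    filter_upwards [eventually_gt_atTop 0] with x hx
    have hg : Measurable fun q => ENNReal.ofReal (scaledTail F x (Z q)) :=
      ((hanti.measurable_scaledTail x).comp hZ).ennreal_ofReal
    have h1 := hcampbell 1 hg
    simp only [ENNReal.coe_one, one_pow, one_mul, NNReal.coe_one, sub_self, zero_mul,
      Real.exp_zero, ENNReal.ofReal_one] at h1
    rw [tsum_measure_weighted_gt hX_meas hX_ident hNmeas hΘ hΘ0 hind hx, h1, mul_div_assoc]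
    simp_rw [ENNReal.ofReal_div_of_pos (hpos x), div_eq_mul_inv]
    rw [lintegral_mul_const' _ _ (ENNReal.inv_ne_top.2 (ENNReal.ofReal_pos.2 (hpos x)).ne')]
  have hLtop : ENNReal.ofReal (cumIntensity lam T) * ∫⁻ q, ENNReal.ofReal (Z q ^ α) ∂ν ≠ ∞ := by
    refine ENNReal.mul_ne_top ENNReal.ofReal_ne_top (ne_top_of_le_ne_top
      (ENNReal.add_ne_top.2 ⟨ENNReal.one_ne_top, hZp⟩) (b := 1 + _) ?_)
    calc ∫⁻ q, ENNReal.ofReal (Z q ^ α) ∂ν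
        ≤ ∫⁻ q, 1 + ENNReal.ofReal (Z q ^ p) ∂ν := by
          refine lintegral_mono fun q => ?_
          rcases le_total (Z q) 1 with h1 | h1
          · exact (ENNReal.ofReal_le_one.2 (Real.rpow_le_one (hZ0 q) h1 hα.le)).trans le_self_add
          · exact (ENNReal.ofReal_le_ofReal
              (Real.rpow_le_rpow_of_exponent_le h1 hp.le)).trans le_add_self
      _ = 1 + ∫⁻ q, ENNReal.ofReal (Z q ^ p) ∂ν := by
          rw [lintegral_add_left measurable_const, lintegral_const, measure_univ, mul_one]
  have hA : ∀ x i, MeasurableSet {ω | i ∈ Finset.Icc 1 (N ω) ∧ x < X i ω * Θ i ω} := fun x i =>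
    (hNmeas (MeasurableSet.of_discrete (s := {n | i ∈ Finset.Icc 1 n}))).inter
      (measurableSet_lt measurable_const ((hX_meas i).mul (hΘ i)))
  have hmain := hX_rv.tendsto_div_of_sandwich hpos
    (Ψ := fun x => μ {ω | (x : EReal) < ⨆ t ∈ Set.Icc (0 : ℝ≥0) T,
      (shotNoise X (fun i ω => h (ξ i ω)) τ t ω : EReal)})
    (R := fun δ x => ∑' i, ∑' j, μ (twoLargeTerms X N Θ δ x i j)) hLtop ha
    (fun δ hδ => tendsto_tsum_measure_twoLargeTerms hX_meas hX_nonneg hX_ident hX_rv hX_indep hα hp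
      hNmeas hΘ hΘ0 hind hmom hδ) ?_ ?_
  · have hreal := (ENNReal.tendsto_toReal hLtop).comp hmain
    have hm0 : 0 ≤ cumIntensity lam T := by
      simpa [cumIntensity] using hN.cumIntensity_mono le_rfl T.2
    have hL : (ENNReal.ofReal (cumIntensity lam T) * ∫⁻ q, ENNReal.ofReal (Z q ^ α) ∂ν).toReal
        = cumIntensity lam T * ∫ ω, h (ζ ω) (V₀ ω) (V₀ ω) ^ α ∂P := by
      rw [ENNReal.toReal_mul, ENNReal.toReal_ofReal hm0, hν,
        lintegral_map' (hZ.pow_const α).ennreal_ofReal.aemeasurable hpair,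
        integral_eq_lintegral_of_nonneg_ae
          (.of_forall fun ω => Real.rpow_nonneg (hh_nonneg _ _ _) α)
          ((hZ.pow_const α).comp_aemeasurable hpair).aestronglyMeasurable]
    rw [hL] at hreal
    refine hreal.congr fun x => ?_
    rw [Function.comp_apply, ENNReal.toReal_div, ENNReal.toReal_ofReal (hpos x).le]
    rfl
  · intro x hx
    refine (tsum_measure_le_measure_iUnion_add (hA x)
      (D := fun i j => twoLargeTerms X N Θ 1 x i j) ?_).trans
      (add_le_add_left (measure_mono (Set.iUnion_subset fun i ω hω =>
        hτ.lt_iSup_shotNoise hX_nonneg hh_nonneg hω.1 hω.2)) _)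
    rintro i j hij ω ⟨⟨hi, hix⟩, hj, hjx⟩
    have hN1 : (1 : ℝ) ≤ N ω := by
      have := Finset.nonempty_Icc.1 ⟨i, hi⟩
      exact_mod_cast this
    refine ⟨⟨hij, hi, hj⟩, ?_, ?_⟩ <;> rw [one_mul]
    · exact hix.trans_le (le_mul_of_one_le_left (hx.trans hix).le hN1)
    · exact hjx.trans_le (le_mul_of_one_le_left (hx.trans hjx).le hN1)
  · intro δ hδ hδ1 x hx
    have hsub : {ω | (x : EReal) < ⨆ t ∈ Set.Icc (0 : ℝ≥0) T,
        (shotNoise X (fun i ω => h (ξ i ω)) τ t ω : EReal)} ≤ᵐ[μ]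
        ((⋃ i, {ω | i ∈ Finset.Icc 1 (N ω) ∧ (1 - δ) * x < X i ω * Θ i ω}) ∪
          ⋃ i, ⋃ j, twoLargeTerms X N Θ δ x i j : Set Ω) := by
      filter_upwards [hN.zero] with ω hω hruin
      have hsum : x < ∑ i ∈ Finset.Icc 1 (N ω), X i ω * Θ i ω := EReal.coe_lt_coe_iff.1
        (lt_of_lt_of_le hruin (hτ.iSup_shotNoise_le hX_nonneg hh_nonneg hh_anti T hω))
      by_cases hbig : ∃ i ∈ Finset.Icc 1 (N ω), (1 - δ) * x < X i ω * Θ i ω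
      · obtain ⟨i, hi, hix⟩ := hbig
        exact Or.inl (Set.mem_iUnion.2 ⟨i, hi, hix⟩)
      · push Not at hbig
        obtain ⟨i, hi, j, hj, hij, hix, hjx⟩ := exists_two_large_of_lt_sum hδ hδ1 hx hsum hbig
        exact Or.inr (Set.mem_iUnion₂.2 ⟨i, j, ⟨hij, hi, hj⟩, hix, hjx⟩)
    refine (measure_mono_ae hsub).trans ((measure_union_le _ _).trans
      (add_le_add (measure_iUnion_le _) ((measure_iUnion_le _).trans
        (ENNReal.tsum_le_tsum fun i => measure_iUnion_le _))))
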